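/- Let $n\ge 1$ be an integer. A Wang tile is a quadruple (right, top, left, bottom) of edge labels; here labels are vectors in $\mathbb Z^3$, with $abc$ short for $(a,b,c)$, $\bar m:=m+1$, and $\widehat{(a,b,c,d)}:=(b,a,d,c)$. Let $$W_n=\{(11\bar i,11\bar j,11i,11j):1\le i,j\le n\},$$ $$B_n=\{(00\bar i,111,00i,11n):0\le i\le n-1\},\qquad G_n=\{(01\bar i,111,00i,11\bar n):0\le i\le n\},\qquad Y_n=\{(01\bar i,112,01i,11\bar n):1\le i\le n\},$$ $$J_n=\{((0,k,l),(0,r,s),(0,s,r+n),(0,l,k+n)) : 0\le k\le l\le 1,\ 0\le r\le s\le 1\}\setminus\{(k,l,r,s)=(0,0,1,1),\,(1,1,0,0)\},$$ $$\mathcal T_n=W_n\cup B_n\cup G_n\cup Y_n\cup \widehat{B_n}\cup\widehat{G_n}\cup\widehat{Y_n}\cup J_n .$$ Let $\Omega_n\subseteq \mathcal T_n^{\mathbb Z^2}$ be the Wang shift of $\mathcal T_n$, i.e. the set of configurations $x:\mathbb Z^2\to\mathcal T_n$ such that the right label of $x_m$ equals the left label of $x_{m+(1,0)}$ and the top label of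 $x_m$ equals the bottom label of $x_{m+(0,1)}$ for every $m\in\mathbb Z^2$. Let $(\sigma^k x)_m=x_{m+k}$ be the shift action and $\overline{X}^{\sigma}=\{\sigma^k x: k\in\mathbb Z^2, x\in X\}$ the shift-closure of $X$. A two-dimensional morphism $\omega$ over an alphabet $\mathcal A$ maps each letter to a finite rectangular word over $\mathcal A$. It is applied to a rectangular word, or to a configuration, by concatenating the images of the letters, which is defined when the images of letters in a common column have equal width and the images of letters in a common row have equal height; the origin of $\omega(x)$ is the lower left corner of the image of $x_0$. It is a two-dimensional substitution $X\to Y$ between subshifts if $\omega(x)$ is defined and belongs to $Y$ for every $x\in X$. It is expansive if for every letter $a$ and every $K\in\mathbb N$ there is an $m$ such that $\omega^m(a)$ has width and height larger than $K$. It is recognizable (in $X$) if for every configuration $y$ there is at most one pair $(k,x)\in\mathbb Z^2\times X$ such that $y=\sigma^k\omega(x)$ and $0\le k<\mathrm{size}(\omega(x_0))$ coordinatewise. A subshift $X$ (a shift-invariant closed set of configurations) is self-similar if $X=\overline{\omega(X)}^{\sigma}$ for some expansive morphism $\omega$. **Theorem A.** For every integer $n\ge 1$, the set $\mathcal T_n$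 consists of $(n+3)^2$ tiles, and its Wang shift $\Omega_n$ is nonempty and self-similar. More precisely, there exists an expansive and recognizable two-dimensional substitution $\omega_n:\Omega_n\to\Omega_n$ which is onto up to a shift, that is, $\Omega_n=\overline{\omega_n(\Omega_n)}^{\sigma}$. -/

import Mathlib

/-! ### Configurations, shifts and subshifts -/

/-- Two-dimensional configurations over the alphabet `A`. -/
abbrev Config (A : Type*) := ℤ × ℤ → A

/-- The shift action: `(σ^k x)_m = x_{m+k}`. -/
def shift {A : Type*} (k : ℤ × ℤ) (x : Config A) : Config A := fun m => x (m + k)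

/-- The shift-closure of a set of configurations (no topological closure is taken). -/
def shiftClosure {A : Type*} (X : Set (Config A)) : Set (Config A) :=
  {y | ∃ k : ℤ × ℤ, ∃ x ∈ X, y = shift k x}

/-- A subshift is a shift-invariant set of configurations which is closed for the product
topology of the discrete topology on the alphabet. -/
def IsSubshift {A : Type*} (X : Set (Config A)) : Prop :=
  @IsClosed (Config A) (@Pi.topologicalSpace (ℤ × ℤ) (fun _ => A) (fun _ => ⊥)) X ∧
    shiftClosure X = X

/-! ### Two-dimensional words and substitutions -/

/-- Two-dimensional words; `get i j` is the letter in column `i` (from the left) and row `j`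
(from the bottom). -/
structure Word (A : Type*) where
  width : ℕ
  height : ℕ
  get : Fin width → Fin height → A

/-- A letter seen as a word of size `1 × 1`. -/
def Word.letter {A : Type*} (a : A) : Word A := ⟨1, 1, fun _ _ => a⟩

/-- The word `u` occurs in the word `v` at position `(k, l)`. -/
def Word.OccursIn {A : Type*} (u v : Word A) (k l : ℕ) : Prop :=
  ∃ (hw : k + u.width ≤ v.width) (hh : l + u.height ≤ v.height),
    ∀ (a : Fin u.width) (b : Fin u.height),
      v.get ⟨k + a, by have := a.isLt; omega⟩ ⟨l + b, by have := b.isLt; omega⟩ = u.get a b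

/-- The word `u` occurs in the configuration `y` at position `(k, l)`. -/
def Word.OccursInConfig {A : Type*} (u : Word A) (y : Config A) (k l : ℤ) : Prop :=
  ∀ (a : Fin u.width) (b : Fin u.height), y (k + (a : ℕ), l + (b : ℕ)) = u.get a b

/-- A two-dimensional morphism is given by the images `ω a` of the letters.
`IsWordImage ω u v` says that `ω(u)` is defined and equal to `v`: the images of the letters in
a column of `u` have the same width, the images of the letters in a row have the same height, and
`v` is the concatenation of these images.  Column `i` of `u` yields the columns `p i, …, p (i+1) - 1`
of `v`, and row `j` of `u` yields the rows `q j, …, q (j+1) - 1`. -/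
def IsWordImage {A B : Type*} (ω : A → Word B) (u : Word A) (v : Word B) : Prop :=
  ∃ p q : ℕ → ℕ,
    p 0 = 0 ∧ q 0 = 0 ∧ p u.width = v.width ∧ q u.height = v.height ∧
    (∀ (i : Fin u.width) (j : Fin u.height), p (i + 1) = p i + (ω (u.get i j)).width) ∧
    (∀ (i : Fin u.width) (j : Fin u.height), q (j + 1) = q j + (ω (u.get i j)).height) ∧
    (∀ (i : Fin u.width) (j : Fin u.height), (ω (u.get i j)).OccursIn v (p i) (q j))

/-- `IsIterate ω m u v` says that `ω^m(u)` is defined and equal to `v`. -/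
def IsIterate {A : Type*} (ω : A → Word A) : ℕ → Word A → Word A → Prop
  | 0, u, v => v = u
  | m + 1, u, v => ∃ w, IsIterate ω m u w ∧ IsWordImage ω w v

/-- `ω` is expansive: for every letter `a` and every `K` there is an `m` such that `ω^m(a)`
is defined and has width and height larger than `K`. -/
def IsExpansive {A : Type*} (ω : A → Word A) : Prop :=
  ∀ (a : A) (K : ℕ), ∃ (m : ℕ) (v : Word A),
    IsIterate ω m (Word.letter a) v ∧ K < min v.width v.height

/-- `IsConfigImage ω x y` says that `ω(x)` is defined and equal to `y`: the images of the letters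
in a column (row) of `x` have the same width (height), and `y` is the concatenation of these images,
placed such that the origin of `y` is the lower left corner of the image of `x (0, 0)`.
The two covering conditions say that the images fill the whole plane. -/
def IsConfigImage {A B : Type*} (ω : A → Word B) (x : Config A) (y : Config B) : Prop :=
  ∃ p q : ℤ → ℤ,
    p 0 = 0 ∧ q 0 = 0 ∧
    (∀ k l : ℤ, p (k + 1) = p k + (ω (x (k, l))).width) ∧
    (∀ k l : ℤ, q (l + 1) = q l + (ω (x (k, l))).height) ∧
    (∀ m : ℤ, ∃ k, p k ≤ m ∧ m < p (k + 1)) ∧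
    (∀ m : ℤ, ∃ l, q l ≤ m ∧ m < q (l + 1)) ∧
    (∀ k l : ℤ, (ω (x (k, l))).OccursInConfig y (p k) (q l))

/-- A two-dimensional substitution `X → Y`: a two-dimensional morphism, given by the images of the
letters, together with the map that it induces on configurations, which sends `X` into `Y`. -/
structure Substitution {A B : Type*} (X : Set (Config A)) (Y : Set (Config B)) where
  rule : A → Word B
  toFun : X → Y
  isConfigImage : ∀ x : X, IsConfigImage rule x.1 (toFun x).1

/-- The image `ω(X)`. -/
def Substitution.image {A B : Type*} {X : Set (Config A)} {Y : Set (Config B)}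
    (ω : Substitution X Y) : Set (Config B) :=
  {y | ∃ x : X, y = (ω.toFun x).1}

/-- `ω : X → Y` is onto up to a shift. -/
def Substitution.IsOntoUpToShift {A B : Type*} {X : Set (Config A)} {Y : Set (Config B)}
    (ω : Substitution X Y) : Prop :=
  Y = shiftClosure ω.image

/-- `(k, x)` is a centered `ω`-representation of `y`: `y = σ^k ω(x)` and `0 ≤ k < size ω(x_0)`. -/
def Substitution.IsCenteredRep {A B : Type*} {X : Set (Config A)} {Y : Set (Config B)}
    (ω : Substitution X Y) (y : Config B) (k : ℤ × ℤ) (x : X) : Prop :=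
  y = shift k (ω.toFun x).1 ∧
    (0 ≤ k.1 ∧ k.1 < (ω.rule (x.1 (0, 0))).width) ∧
    (0 ≤ k.2 ∧ k.2 < (ω.rule (x.1 (0, 0))).height)

/-- `ω` is recognizable in its domain: every configuration has at most one centered
`ω`-representation. -/
def Substitution.IsRecognizable {A B : Type*} {X : Set (Config A)} {Y : Set (Config B)}
    (ω : Substitution X Y) : Prop :=
  ∀ (y : Config B) (k k' : ℤ × ℤ) (x x' : X),
    ω.IsCenteredRep y k x → ω.IsCenteredRep y k' x' → k = k' ∧ x = x'

/-- A subshift `X` is self-similar if `X` is the shift-closure of `ω(X)` for some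
expansive two-dimensional morphism `ω`. -/
def IsSelfSimilar {A : Type*} (X : Set (Config A)) : Prop :=
  IsSubshift X ∧ ∃ ω : Substitution X X, IsExpansive ω.rule ∧ X = shiftClosure ω.image

/-! ### Wang tiles and Wang shifts -/

/-- A Wang tile, with the colors of its right, top, left and bottom edges, in this order. -/
structure WangTile (C : Type*) where
  right : C
  top : C
  left : C
  bottom : C

/-- The image of a Wang tile under the reflection through the positive diagonal. -/
def WangTile.hat {C : Type*} (t : WangTile C) : WangTile C := ⟨t.top, t.right, t.bottom, t.left⟩

/-- The Wang shift of a set `T` of Wang tiles: the valid configurations `ℤ² → T`. -/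
def wangShift {C : Type*} (T : Set (WangTile C)) : Set (Config T) :=
  {x | ∀ i j : ℤ, (x (i, j)).1.right = (x (i + 1, j)).1.left ∧
    (x (i, j)).1.top = (x (i, j + 1)).1.bottom}

/-! ### The metallic mean Wang tiles -/

namespace MetallicMean

/-- Edge labels; the label written `abc` is `(a, b, c)`. -/
abbrev Label := ℤ × ℤ × ℤ

/-- White tiles. -/
def W (n : ℕ) : Set (WangTile Label) :=
  {t | ∃ i j : ℤ, (1 ≤ i ∧ i ≤ n) ∧ (1 ≤ j ∧ j ≤ n) ∧
    t = ⟨(1, 1, i + 1), (1, 1, j + 1), (1, 1, i), (1, 1, j)⟩}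

/-- Horizontal blue stripe tiles, including the last one (`i = n`). -/
def B' (n : ℕ) : Set (WangTile Label) :=
  {t | ∃ i : ℤ, (0 ≤ i ∧ i ≤ n) ∧ t = ⟨(0, 0, i + 1), (1, 1, 1), (0, 0, i), (1, 1, n)⟩}

/-- Horizontal green stripe tiles. -/
def G (n : ℕ) : Set (WangTile Label) :=
  {t | ∃ i : ℤ, (0 ≤ i ∧ i ≤ n) ∧ t = ⟨(0, 1, i + 1), (1, 1, 1), (0, 0, i), (1, 1, n + 1)⟩}

/-- Horizontal yellow stripe tiles. -/
def Y (n : ℕ) : Set (WangTile Label) :=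
  {t | ∃ i : ℤ, (1 ≤ i ∧ i ≤ n) ∧ t = ⟨(0, 1, i + 1), (1, 1, 2), (0, 1, i), (1, 1, n + 1)⟩}

/-- Horizontal antigreen tiles. -/
def A (n : ℕ) : Set (WangTile Label) :=
  {t | ∃ i : ℤ, (1 ≤ i ∧ i ≤ n) ∧ t = ⟨(0, 0, i + 1), (1, 1, 2), (0, 1, i), (1, 1, n)⟩}

/-- The junction tile with right label `(0,k,l)`, top label `(0,r,s)`, left label `(0,s,r+n)` and
bottom label `(0,l,k+n)`. -/
def junction (n : ℕ) (k l r s : ℤ) : WangTile Label :=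
  ⟨(0, k, l), (0, r, s), (0, s, r + n), (0, l, k + n)⟩

/-- The nine junction tiles. -/
def J' (n : ℕ) : Set (WangTile Label) :=
  {t | ∃ k l r s : ℤ, (0 ≤ k ∧ k ≤ l ∧ l ≤ 1) ∧ (0 ≤ r ∧ r ≤ s ∧ s ≤ 1) ∧
    t = junction n k l r s}

/-- The extended set of metallic mean Wang tiles. -/
def extendedTiles (n : ℕ) : Set (WangTile Label) :=
  W n ∪ B' n ∪ G n ∪ Y n ∪ A n ∪
    WangTile.hat '' B' n ∪ WangTile.hat '' G n ∪ WangTile.hat '' Y n ∪ WangTile.hat '' A n ∪ J' n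

/-- The last blue horizontal tile, the last blue vertical tile, and two junction tiles. -/
def D (n : ℕ) : Set (WangTile Label) :=
  {⟨(1, 1, 1), (0, 0, n + 1), (1, 1, n), (0, 0, n)⟩,
    ⟨(0, 0, n + 1), (1, 1, 1), (0, 0, n), (1, 1, n)⟩,
    junction n 0 0 1 1, junction n 1 1 0 0}

/-- The set of metallic mean Wang tiles. -/
def tiles (n : ℕ) : Set (WangTile Label) :=
  extendedTiles n \ (A n ∪ WangTile.hat '' A n ∪ D n)

/-- The metallic mean Wang shift. -/
def Omega (n : ℕ) : Set (Config (tiles n)) := wangShift (tiles n)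

end MetallicMean

/-! The substitution sends a tile with bottom label `e` and left label `f` to a block of width `n +
1 - e.1` and height `n + 1 - f.1`: a junction in the lower left corner, stripe tiles along the
bottom row and the left column, white tiles elsewhere. The bottom labels of the block depend on `e`
alone. Along its stripe the middle bits change from 0 to 1 at most once; `greenPos e` records the
threshold and `startIndex e` the index at which the stripe starts. The left column encodes `f` in
the same way.

Reading the top row of a block yields exactly the encoding of the top label of the tile
(`Tight.edge_top`), and blocks consist of valid tiles (`Tight.edge`). Hence blocks of adjacent tiles
match, and valid configurations map to valid configurations.

Conversely, in a valid configuration horizontal and vertical stripes recur at distances `n` or `n +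
1` and cut the plane into blocks, each of which encodes a bottom and a left label. Matching
boundaries of neighboring blocks force these labels to form a tile (`Loose.of_edge`), but only one
of a larger class that includes antigreen tiles and all nine junctions. The excess is removed by a
global argument (`LooseGrid.tight`): an antigreen tile propagates down a diagonal that never meets a
vertical stripe, and a forbidden junction contradicts the distance of stripes. This gives
`TightGrid.exists_blocks`, hence surjectivity up to a shift.

Recognizability holds because the stripes of the image are exactly the block boundaries, and a label
can be recovered from the boundary of its block. Expansivity follows from the junction in each lower
left corner, whose image has both sides of length `n + 1`. The resulting large patches give
nonemptiness by compactness. -/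

namespace MetallicMean

/-! ### Tiles as linear conditions on labels -/

/-- The labels of a white tile. -/
def IsWhite (n : ℤ) (R T L B : Label) : Prop :=
  L.1 = 1 ∧ R.1 = 1 ∧ B.1 = 1 ∧ T.1 = 1 ∧ L.2.1 = 1 ∧ R.2.1 = 1 ∧ B.2.1 = 1 ∧ T.2.1 = 1 ∧
    R.2.2 = L.2.2 + 1 ∧ T.2.2 = B.2.2 + 1 ∧ 1 ≤ L.2.2 ∧ L.2.2 ≤ n ∧ 1 ≤ B.2.2 ∧ B.2.2 ≤ n

/-- The labels of a horizontal stripe tile: blue, green, yellow or antigreen. -/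
def IsStripe (n : ℤ) (R T L B : Label) : Prop :=
  L.1 = 0 ∧ R.1 = 0 ∧ B.1 = 1 ∧ T.1 = 1 ∧ B.2.1 = 1 ∧ T.2.1 = 1 ∧
    R.2.2 = L.2.2 + 1 ∧ T.2.2 = 1 + L.2.1 ∧ B.2.2 = n + R.2.1 ∧
    0 ≤ L.2.1 ∧ L.2.1 ≤ 1 ∧ 0 ≤ R.2.1 ∧ R.2.1 ≤ 1 ∧
    L.2.1 ≤ L.2.2 ∧ L.2.2 ≤ n + L.2.1 ∧ R.2.1 ≤ R.2.2 ∧ R.2.2 ≤ n + R.2.1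

/-- The labels of one of the nine junctions. -/
def IsJunction (n : ℤ) (R T L B : Label) : Prop :=
  L.1 = 0 ∧ R.1 = 0 ∧ B.1 = 0 ∧ T.1 = 0 ∧ 0 ≤ R.2.1 ∧ R.2.1 ≤ R.2.2 ∧ R.2.2 ≤ 1 ∧
    0 ≤ T.2.1 ∧ T.2.1 ≤ T.2.2 ∧ T.2.2 ≤ 1 ∧ L.2.1 = T.2.2 ∧ L.2.2 = T.2.1 + n ∧
    B.2.1 = R.2.2 ∧ B.2.2 = R.2.1 + n

/-- The labels of a tile, where antigreen tiles and all nine junctions are allowed. -/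
def Loose (n : ℤ) (R T L B : Label) : Prop :=
  IsWhite n R T L B ∨ IsStripe n R T L B ∨ IsStripe n T R B L ∨ IsJunction n R T L B

/-- The labels of a tile of `tiles n`. -/
def Tight (n : ℤ) (R T L B : Label) : Prop :=
  IsWhite n R T L B ∨ (IsStripe n R T L B ∧ L.2.1 ≤ R.2.1) ∨
    (IsStripe n T R B L ∧ B.2.1 ≤ T.2.1) ∨
    (IsJunction n R T L B ∧ ¬(R.2.1 = 1 ∧ T.2.2 = 0) ∧ ¬(R.2.2 = 0 ∧ T.2.1 = 1))

theorem IsWhite.hat {n : ℤ} {R T L B : Label} (h : IsWhite n R T L B) : IsWhite n T R B L := by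
  unfold IsWhite at *; omega

theorem IsJunction.hat {n : ℤ} {R T L B : Label} (h : IsJunction n R T L B) :
    IsJunction n T R B L := by
  unfold IsJunction at *; omega

theorem Loose.hat {n : ℤ} {R T L B : Label} (h : Loose n R T L B) : Loose n T R B L := by
  rcases h with h | h | h | h
  exacts [.inl h.hat, .inr (.inr (.inl h)), .inr (.inl h), .inr (.inr (.inr h.hat))]

theorem Tight.hat {n : ℤ} {R T L B : Label} (h : Tight n R T L B) : Tight n T R B L := by
  rcases h with h | h | h | ⟨h, h', h''⟩
  exacts [.inl h.hat, .inr (.inr (.inl h)), .inr (.inl h),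
    .inr (.inr (.inr ⟨h.hat, fun k => h'' k.symm, fun k => h' k.symm⟩))]

theorem Tight.loose {n : ℤ} {R T L B : Label} (h : Tight n R T L B) : Loose n R T L B := by
  rcases h with h | h | h | h
  exacts [.inl h, .inr (.inl h.1), .inr (.inr (.inl h.1)), .inr (.inr (.inr h.1))]

/-- Trades the set description for linear inequalities over the integers, so that later case checks
on tiles become pure arithmetic. -/
theorem mem_tiles_iff {n : ℕ} (t : WangTile Label) :
    t ∈ tiles n ↔ Tight n t.right t.top t.left t.bottom := by
  obtain ⟨⟨a1, a2, a3⟩, ⟨b1, b2, b3⟩, ⟨c1, c2, c3⟩, ⟨d1, d2, d3⟩⟩ := t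
  constructor
  · rintro ⟨h, hn⟩
    simp only [extendedTiles, Set.mem_union, Set.mem_image, W, B', G, Y, A, J', D, junction,
      Set.mem_ofPred_eq, Set.mem_insert_iff, Set.mem_singleton_iff, not_or, not_exists] at h hn
    obtain ⟨⟨hA, hA'⟩, hD1, hD2, hD3, hD4⟩ := hn
    simp only [WangTile.mk.injEq, Prod.mk.injEq] at hD1 hD2 hD3 hD4
    rcases h with ((((((((h | h) | h) | h) | h) | h) | h) | h) | h) | h
    · obtain ⟨i, j, hi, hj, e⟩ := h
      clear hD1 hD2 hD3 hD4
      simp only [WangTile.mk.injEq, Prod.mk.injEq] at e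
      refine .inl ?_
      simp only [IsWhite]; omega
    · obtain ⟨i, hi, e⟩ := h
      clear hD1 hD3 hD4
      simp only [WangTile.mk.injEq, Prod.mk.injEq] at e
      refine .inr (.inl ?_)
      simp only [IsStripe]; omega
    · obtain ⟨i, hi, e⟩ := h
      clear hD1 hD2 hD3 hD4
      simp only [WangTile.mk.injEq, Prod.mk.injEq] at e
      refine .inr (.inl ?_)
      simp only [IsStripe]; omega
    · obtain ⟨i, hi, e⟩ := h
      clear hD1 hD2 hD3 hD4
      simp only [WangTile.mk.injEq, Prod.mk.injEq] at e
      refine .inr (.inl ?_)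
      simp only [IsStripe]; omega
    · obtain ⟨i, hi, e⟩ := h
      exact absurd ⟨hi, e⟩ (hA i)
    · obtain ⟨_, ⟨i, hi, rfl⟩, e⟩ := h
      clear hD2 hD3 hD4
      simp only [WangTile.hat, WangTile.mk.injEq, Prod.mk.injEq] at e
      refine .inr (.inr (.inl ?_))
      simp only [IsStripe]; omega
    · obtain ⟨_, ⟨i, hi, rfl⟩, e⟩ := h
      clear hD1 hD2 hD3 hD4
      simp only [WangTile.hat, WangTile.mk.injEq, Prod.mk.injEq] at e
      refine .inr (.inr (.inl ?_))
      simp only [IsStripe]; omega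
    · obtain ⟨_, ⟨i, hi, rfl⟩, e⟩ := h
      clear hD1 hD2 hD3 hD4
      simp only [WangTile.hat, WangTile.mk.injEq, Prod.mk.injEq] at e
      refine .inr (.inr (.inl ?_))
      simp only [IsStripe]; omega
    · obtain ⟨s, ⟨i, hi, rfl⟩, e⟩ := h
      exact absurd ⟨⟨i, hi, rfl⟩, e⟩ (hA' _)
    · obtain ⟨k, l, r, s, hk, hr, e⟩ := h
      clear hD1 hD2
      simp only [WangTile.mk.injEq, Prod.mk.injEq] at e
      refine .inr (.inr (.inr ⟨?_, ?_, ?_⟩))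
      · simp only [IsJunction]; omega
      · clear hD3; dsimp only; omega
      · clear hD4; dsimp only; omega
  · intro h
    simp only [Tight, IsWhite, IsStripe, IsJunction] at h
    constructor
    · simp only [extendedTiles, Set.mem_union, Set.mem_image, W, B', G, Y, A, J', junction,
        Set.mem_ofPred_eq]
      rcases h with h | h | h | h
      · iterate 9 left
        refine ⟨c3, d3, by omega, by omega, ?_⟩
        simp only [WangTile.mk.injEq, Prod.mk.injEq, and_true]; omega
      · by_cases hr : a2 = 0
        · iterate 8 left
          right
          refine ⟨c3, by omega, ?_⟩
          simp only [WangTile.mk.injEq, Prod.mk.injEq, and_true]; omega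
        · by_cases hl : c2 = 0
          · iterate 7 left
            right
            refine ⟨c3, by omega, ?_⟩
            simp only [WangTile.mk.injEq, Prod.mk.injEq, and_true]; omega
          · iterate 6 left
            right
            refine ⟨c3, by omega, ?_⟩
            simp only [WangTile.mk.injEq, Prod.mk.injEq, and_true]; omega
      · by_cases hr : b2 = 0
        · iterate 4 left
          right
          refine ⟨_, ⟨d3, by omega, rfl⟩, ?_⟩
          simp only [WangTile.hat, WangTile.mk.injEq, Prod.mk.injEq, and_true]; omega
        · by_cases hl : d2 = 0
          · iterate 3 left
            right
            refine ⟨_, ⟨d3, by omega, rfl⟩, ?_⟩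
            simp only [WangTile.hat, WangTile.mk.injEq, Prod.mk.injEq, and_true]; omega
          · iterate 2 left
            right
            refine ⟨_, ⟨d3, by omega, rfl⟩, ?_⟩
            simp only [WangTile.hat, WangTile.mk.injEq, Prod.mk.injEq, and_true]; omega
      · right
        refine ⟨a2, a3, b2, b3, by omega, by omega, ?_⟩
        simp only [WangTile.mk.injEq, Prod.mk.injEq, and_true]; omega
    · simp only [Set.mem_union, Set.mem_image, A, D, junction,
        Set.mem_ofPred_eq, Set.mem_insert_iff, Set.mem_singleton_iff]
      rintro ((⟨i, hi, e⟩ | ⟨_, ⟨i, hi, rfl⟩, e⟩) | e | e | e | e)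
      all_goals
        simp only [WangTile.hat, WangTile.mk.injEq, Prod.mk.injEq] at e
        rcases h with h | h | h | h <;> omega

/-! ### Blocks and their boundaries -/

/-- The labels that occur on the edges of the tiles. -/
def IsLabel (n : ℤ) (e : Label) : Prop :=
  (e.1 = 1 ∧ e.2.1 = 1 ∧ 1 ≤ e.2.2 ∧ e.2.2 ≤ n + 1) ∨
    (e.1 = 0 ∧ 0 ≤ e.2.1 ∧ e.2.1 ≤ 1 ∧ e.2.1 ≤ e.2.2 ∧ e.2.2 ≤ n + e.2.1)

/-- The width (or height) of the blocks with bottom (or left) label `e`. -/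
def width (n : ℤ) (e : Label) : ℤ := n + 1 - e.1

/-- The position of the green tile in the stripe of a block. -/
def greenPos (e : Label) : ℤ := e.2.2 - 1 - e.1

/-- The last coordinate of the label following the junction of a block. -/
def startIndex (e : Label) : ℤ := 1 - e.2.1 + e.1

/-- The middle coordinate of the label following the junction of a block. -/
def startBit (e : Label) : ℤ := if greenPos e < 0 then 1 else 0

/-- The label of the bottom edge at position `(a, b)` in the block with bottom label `e` and left
label `f`.  The left edge has label `edge n f e b a`. -/
def edge (n : ℤ) (e f : Label) (a b : ℤ) : Label :=
  if a = 0 then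
    (0, if b = 0 then startIndex e else if greenPos f < b - 1 then 1 else 0,
      if b = 0 then startBit e + n else startIndex f + b - 1)
  else (1, 1, if b = 0 then n + (if greenPos e < a then 1 else 0)
    else b + (if greenPos e < a - 1 then 1 else 0))

theorem Loose.isLabel {n : ℤ} (hn : 1 ≤ n) {R T L B : Label} (h : Loose n R T L B) :
    IsLabel n R ∧ IsLabel n T ∧ IsLabel n L ∧ IsLabel n B := by
  simp only [Loose, IsWhite, IsStripe, IsJunction] at h
  simp only [IsLabel]
  rcases h with h | h | h | h <;> refine ⟨?_, ?_, ?_, ?_⟩ <;> omega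

/-- The blocks of vertically adjacent tiles match. -/
theorem Tight.edge_top {n : ℤ} (hn : 1 ≤ n) {R T L B : Label} (h : Tight n R T L B) (f : Label)
    {a : ℤ} (ha : 0 ≤ a) (ha' : a < width n B) : edge n B L a (width n L) = edge n T f a 0 := by
  simp only [Tight, IsWhite, IsStripe, IsJunction] at h
  simp only [edge, width, greenPos, startIndex, startBit] at *
  rcases h with h | h | h | h
  all_goals split_ifs <;> first | (exfalso; omega) | (simp only [Prod.mk.injEq, true_and]; omega)

/-- The blocks of valid tiles consist of valid tiles. -/
theorem Tight.edge {n : ℤ} (hn : 1 ≤ n) {R T L B : Label} (h : Tight n R T L B)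
    {a b : ℤ} (ha : 0 ≤ a) (ha' : a < width n B) (hb : 0 ≤ b) (hb' : b < width n L) :
    Tight n (edge n L B b (a + 1)) (edge n B L a (b + 1)) (edge n L B b a) (edge n B L a b) := by
  have h1 : ¬ a + 1 = 0 := by omega
  have h2 : ¬ b + 1 = 0 := by omega
  have hl := h.loose.isLabel hn
  simp only [Tight, IsWhite, IsStripe, IsJunction] at h
  simp only [MetallicMean.edge, width, greenPos, startIndex, startBit, IsLabel] at *
  simp only [h1, h2, if_false]
  -- Corner, left column, bottom row, interior. On the two stripes the ranges of the labels suffice;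
  -- the corner and the interior need to know which tile is substituted.
  by_cases ha0 : a = 0 <;> by_cases hb0 : b = 0 <;> simp only [ha0, hb0, if_true, if_false]
  · refine .inr (.inr (.inr ⟨?_, ?_, ?_⟩))
    · simp only [IsJunction, true_and]; split_ifs <;> omega
    · dsimp only; split_ifs <;> rcases h with h | h | h | h <;> omega
    · dsimp only; split_ifs <;> rcases h with h | h | h | h <;> omega
  · refine .inr (.inr (.inl ?_))
    clear h
    simp only [IsStripe, true_and]; split_ifs <;> omega
  · refine .inr (.inl ?_)
    clear h
    simp only [IsStripe, true_and]; split_ifs <;> omega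
  · refine .inl ?_
    simp only [IsWhite, true_and]; split_ifs <;> rcases h with h | h | h | h <;> omega

/-! ### Recovering labels from matching blocks -/

theorem start_of_edge {n : ℤ} {T L B f : Label}
    (h : edge n B L 0 (width n L) = edge n T f 0 0) (hL : 0 < width n L) :
    ((startIndex T = 1 ∧ greenPos L < width n L - 1) ∨
      (startIndex T = 0 ∧ width n L - 1 ≤ greenPos L)) ∧
    startBit T + n = startIndex L + width n L - 1 := by
  simp only [edge, hL.ne', if_true, if_false, Prod.mk.injEq, true_and] at h
  split_ifs at h <;> omega

theorem startBit_spec (e : Label) :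
    (startBit e = 1 ∧ greenPos e < 0) ∨ (startBit e = 0 ∧ 0 ≤ greenPos e) := by
  unfold startBit; split_ifs <;> omega

/-- The last coordinates give `width n L + x = n + y` with bits `x` and `y`, which leaves three
possible widths. The value `n - 1` is ruled out at the call sites. -/
theorem bits_of_edge {n : ℤ} {T L B f : Label} {a : ℤ}
    (h : edge n B L a (width n L) = edge n T f a 0) (ha : 0 < a) (hL : 0 < width n L) :
    width n L = n ∧ (greenPos B < a - 1 ↔ greenPos T < a) ∨
      width n L = n + 1 ∧ ¬ greenPos B < a - 1 ∧ greenPos T < a ∨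
      width n L = n - 1 := by
  simp only [edge, hL.ne', ha.ne', if_true, if_false, Prod.mk.injEq, true_and] at h
  split_ifs at h <;> omega

/-- The bottom and top labels of a block with a low left edge. -/
theorem label_succ_of_edge {n : ℤ} (hn : 1 ≤ n) {T L B f : Label}
    (hT : IsLabel n T) (hB : IsLabel n B) (hTB : T.1 = B.1) (hL : L.1 = 1)
    (hPB : greenPos B < width n B - 1) (hPT : 0 ≤ greenPos T)
    (htop : ∀ a, 0 ≤ a → a < width n B → edge n B L a (width n L) = edge n T f a 0) :
    T.2.2 = B.2.2 + 1 := by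
  have hw : width n L = n := by simp [width, hL]
  -- From the bottom to the top of a block of height `n` the threshold moves one place to the right.
  -- The two columns chosen here are the ones where a smaller or a larger threshold of `T` would
  -- show.
  have t2 := fun h h' => bits_of_edge (htop (greenPos B + 1) h h')
  have t3 := fun h h' => bits_of_edge (htop (greenPos T) h h')
  simp only [IsLabel, width, greenPos] at *
  by_contra hne
  rcases lt_or_gt_of_ne hne with hlt | hlt
  · have := t2 (by omega) (by omega) (by omega) (by omega)
    omega
  · have := t3 (by omega) (by omega) (by omega) (by omega)
    omega

/-- The bottom and top labels of a block with a high left edge. -/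
theorem greenPos_of_edge {n : ℤ} (hn : 1 ≤ n) {T L B f : Label}
    (hB : IsLabel n B) (hL : L.1 = 0)
    (htop : ∀ a, 0 ≤ a → a < width n B → edge n B L a (width n L) = edge n T f a 0) :
    width n B - 2 ≤ greenPos B ∧ (greenPos T ≤ 0 ∨ width n B = 1) := by
  have hw : width n L = n + 1 := by simp [width, hL]
  by_cases h1 : width n B = 1
  · refine ⟨?_, .inr h1⟩
    simp only [IsLabel, width, greenPos] at *; omega
  · have t2 := fun h h' => bits_of_edge (htop (width n B - 1) h h')
    have t1 := fun h h' => bits_of_edge (htop 1 h h')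
    have hB0 : 1 < width n B := by
      simp only [IsLabel, width] at *; omega
    replace t2 := t2 (by omega) (by omega) (by omega) (by omega)
    replace t1 := t1 (by omega) (by omega) (by omega) (by omega)
    constructor <;> omega

theorem Loose.of_edge {n : ℤ} (hn : 1 ≤ n) {R T L B f g : Label} (hR : IsLabel n R)
    (hT : IsLabel n T) (hL : IsLabel n L) (hB : IsLabel n B) (hTB : T.1 = B.1) (hRL : R.1 = L.1)
    (htop : ∀ a, 0 ≤ a → a < width n B → MetallicMean.edge n B L a (width n L) =
      MetallicMean.edge n T f a 0)
    (hright : ∀ b, 0 ≤ b → b < width n L → MetallicMean.edge n L B b (width n B) =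
      MetallicMean.edge n R g b 0) : Loose n R T L B := by
  have wB : 0 < width n B := by simp only [IsLabel, width] at *; omega
  have wL : 0 < width n L := by simp only [IsLabel, width] at *; omega
  have t0 := start_of_edge (htop 0 le_rfl wB) wL
  have r0 := start_of_edge (hright 0 le_rfl wL) wB
  have t1 := label_succ_of_edge (n := n) (T := T) (B := B) (L := L) (f := f) hn hT hB hTB
  have r1 := label_succ_of_edge (n := n) (T := R) (B := L) (L := B) (f := g) hn hR hL hRL
  have t2 := greenPos_of_edge (n := n) (T := T) (B := B) (L := L) (f := f) hn hB
  have r2 := greenPos_of_edge (n := n) (T := R) (B := L) (L := B) (f := g) hn hL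
  have sT := startBit_spec T
  have sR := startBit_spec R
  obtain ⟨t0, t0'⟩ := t0
  obtain ⟨r0, r0'⟩ := r0
  simp only [width, greenPos, startIndex] at wB wL t0 r0 t0' r0' t1 r1 t2 r2 sT sR htop hright
  have hL' := hL
  have hB' := hB
  simp only [IsLabel] at hR hT hL' hB'
  -- The first coordinates of `L` and `B` decide the kind of tile: white, vertical stripe,
  -- horizontal stripe, junction.
  rcases hL' with hL' | hL' <;> rcases hB' with hB' | hB'
  · replace t1 := t1 hL'.1 (by omega) (by omega) htop
    replace r1 := r1 hB'.1 (by omega) (by omega) hright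
    clear t2 r2
    refine .inl ?_
    simp only [IsWhite]; omega
  · replace t1 := t1 hL'.1 (by omega) (by omega) htop
    replace r2 := r2 hB'.1 hright
    clear t2 r1
    refine .inr (.inr (.inl ?_))
    simp only [IsStripe]; omega
  · replace t2 := t2 hL'.1 htop
    replace r1 := r1 hB'.1 (by omega) (by omega) hright
    clear t1 r2
    refine .inr (.inl ?_)
    simp only [IsStripe]; omega
  · replace t2 := t2 hL'.1 htop
    replace r2 := r2 hB'.1 hright
    clear t1 r1
    refine .inr (.inr (.inr ?_))
    simp only [IsJunction]; omega

/-- The width gives `e.1`, the corner gives `startIndex`, and the bits give `greenPos`; together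
these are the three coordinates. Thresholds -1 and 0 look the same off the corner and are told apart
by `startBit`. -/
theorem label_eq_of_edge {n : ℤ} {e e' f f' : Label} (hn : 1 ≤ n) (he : IsLabel n e)
    (he' : IsLabel n e') (hw : width n e = width n e')
    (h : ∀ a, 0 ≤ a → a < width n e → edge n e f a 0 = edge n e' f' a 0) : e = e' := by
  have h0 := h 0 le_rfl
  have h1 := h (greenPos e)
  have h2 := h (greenPos e')
  clear h
  have key : greenPos e = greenPos e' := by
    unfold IsLabel at he he'
    simp only [edge, width, greenPos, startIndex, startBit, if_true] at *
    by_contra hne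
    split_ifs at h0 <;> simp only [Prod.mk.injEq] at h0 <;> try omega
    · rcases lt_or_gt_of_ne hne with hlt | hlt
      · clear h1
        replace h2 := h2 (by omega) (by omega)
        split_ifs at h2 <;> simp only [Prod.mk.injEq] at h2 <;> omega
      · clear h2
        replace h1 := h1 (by omega) (by omega)
        split_ifs at h1 <;> simp only [Prod.mk.injEq] at h1 <;> omega
  unfold IsLabel at he he'
  simp only [edge, width, greenPos, startIndex, startBit, if_true, Prod.mk.injEq] at *
  refine Prod.ext ?_ (Prod.ext ?_ ?_) <;> omega

/-! ### Partial sums, enumerations and thresholds over the integers -/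

theorem strictMono_of_lt_add_one {p : ℤ → ℤ} (hp : ∀ k, p k < p (k + 1)) : StrictMono p :=
  strictMono_int_of_lt_succ hp

theorem exists_le_lt_add_one {p : ℤ → ℤ} (hp : ∀ k, p k < p (k + 1)) (m : ℤ) :
    ∃ k, p k ≤ m ∧ m < p (k + 1) := by
  have hmono : Monotone fun k => p k - k :=
    monotone_int_of_le_succ fun k => by have := hp k; omega
  obtain ⟨k, hk, hk'⟩ := Int.exists_greatest_of_bdd (P := fun k => p k ≤ m)
    ⟨max 0 (m - p 0), fun k hk => by
      by_contra! h
      have := hmono (show (0 : ℤ) ≤ k by omega)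
      simp only at this; omega⟩
    ⟨min 0 (m - p 0), by
      have := hmono (show min 0 (m - p 0) ≤ (0 : ℤ) by omega)
      simp only at this; omega⟩
  refine ⟨k, hk, ?_⟩
  by_contra! h
  have := hk' _ h
  omega

theorem eq_of_le_lt_add_one {p : ℤ → ℤ} (hp : ∀ k, p k < p (k + 1)) {m k l : ℤ}
    (hk : p k ≤ m) (hk' : m < p (k + 1)) (hl : p l ≤ m) (hl' : m < p (l + 1)) : k = l := by
  have hm := strictMono_of_lt_add_one hp
  have h1 := hm.lt_iff_lt.1 (hk.trans_lt hl')
  have h2 := hm.lt_iff_lt.1 (hl.trans_lt hk')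
  omega

/-- Integer powers of the permutation `(k, s) ↦ (k + 1, s + w k)` supply the recursion in both
directions at once. -/
theorem exists_partialSums (w : ℤ → ℤ) : ∃ p : ℤ → ℤ, p 0 = 0 ∧ ∀ k, p (k + 1) = p k + w k := by
  let σ : Equiv.Perm (ℤ × ℤ) :=
    { toFun := fun x => (x.1 + 1, x.2 + w x.1)
      invFun := fun x => (x.1 - 1, x.2 - w (x.1 - 1))
      left_inv := fun x => by simp
      right_inv := fun x => by simp }
  have hσ : ∀ k : ℤ, (σ ^ (k + 1)) (0, 0) = σ ((σ ^ k) (0, 0)) := fun k => by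
    rw [add_comm, zpow_add, zpow_one, Equiv.Perm.mul_apply]
  have h1 : ∀ k : ℤ, ((σ ^ k) (0, 0)).1 = k := fun k => by
    induction k using Int.induction_on with
    | zero => simp
    | succ k ih => rw [hσ]; simp [σ] at ih ⊢; omega
    | pred k ih =>
      have := hσ (-(k : ℤ) - 1)
      rw [sub_add_cancel] at this
      rw [this] at ih
      simp [σ] at ih ⊢; omega
  refine ⟨fun k => ((σ ^ k) (0, 0)).2, by simp, fun k => ?_⟩
  beta_reduce
  rw [hσ]
  change _ + w ((σ ^ k) (0, 0)).1 = _
  rw [h1]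

theorem eq_partialSums {p q w : ℤ → ℤ} (h0 : p 0 = q 0) (hp : ∀ k, p (k + 1) = p k + w k)
    (hq : ∀ k, q (k + 1) = q k + w k) : p = q := by
  funext k
  induction k using Int.induction_on with
  | zero => exact h0
  | succ k ih => rw [hp, hq, ih]
  | pred k ih =>
    have h1 := hp (-(k : ℤ) - 1)
    have h2 := hq (-(k : ℤ) - 1)
    rw [sub_add_cancel] at h1 h2
    omega

/-- A set of integers that is unbounded in both directions can be enumerated. -/
theorem exists_enumeration {S : Set ℤ} (hu : ∀ m, ∃ s ∈ S, m < s) (hl : ∀ m, ∃ s ∈ S, s < m) :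
    ∃ p : ℤ → ℤ, (∀ k, p k ∈ S) ∧ (∀ k, p k < p (k + 1)) ∧
      ∀ k s, p k < s → s < p (k + 1) → s ∉ S := by
  have hnext : ∀ a : S, ∃ b : S, a.1 < b ∧ ∀ s : ℤ, a < s → s < b.1 → s ∉ S := fun a => by
    obtain ⟨b, hb, hb'⟩ := Int.exists_least_of_bdd (P := fun s => s ∈ S ∧ a < s)
      ⟨a, fun z hz => hz.2.le⟩ (hu a)
    exact ⟨⟨b, hb.1⟩, hb.2, fun s h1 h2 h3 => absurd (hb' s ⟨h3, h1⟩) (not_le.2 h2)⟩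
  have hprev : ∀ a : S, ∃ b : S, b.1 < a ∧ ∀ s : ℤ, b < s → s < a.1 → s ∉ S := fun a => by
    obtain ⟨b, hb, hb'⟩ := Int.exists_greatest_of_bdd (P := fun s => s ∈ S ∧ s < a)
      ⟨a, fun z hz => hz.2.le⟩ (hl a)
    exact ⟨⟨b, hb.1⟩, hb.2, fun s h1 h2 h3 => absurd (hb' s ⟨h3, h2⟩) (not_le.2 h1)⟩
  choose f hf hf' using hnext
  choose g hg hg' using hprev
  -- Next and previous element are mutually inverse, so the orbit of one point under the powers of
  -- this permutation is the enumeration.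
  let σ : Equiv.Perm S :=
    { toFun := f
      invFun := g
      left_inv := fun a => by
        have h1 := hf a; have h2 := hg (f a)
        rcases lt_trichotomy (g (f a)).1 a.1 with h | h | h
        · exact absurd a.2 (hg' (f a) a h h1)
        · exact Subtype.ext h
        · exact absurd (g (f a)).2 (hf' a _ h h2)
      right_inv := fun a => by
        have h1 := hg a; have h2 := hf (g a)
        rcases lt_trichotomy (f (g a)).1 a.1 with h | h | h
        · exact absurd (f (g a)).2 (hg' a _ h2 h)
        · exact Subtype.ext h
        · exact absurd a.2 (hf' (g a) _ h1 h) }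
  obtain ⟨s, hs, -⟩ := hu 0
  have hσ : ∀ k : ℤ, (σ ^ (k + 1)) ⟨s, hs⟩ = f ((σ ^ k) ⟨s, hs⟩) := fun k => by
    rw [add_comm, zpow_add, zpow_one, Equiv.Perm.mul_apply]; rfl
  refine ⟨fun k => ((σ ^ k) ⟨s, hs⟩).1, fun k => Subtype.prop _, fun k => ?_, fun k t => ?_⟩
  · beta_reduce; rw [hσ]; exact hf _
  · beta_reduce; rw [hσ]; exact hf' _ t

theorem enumeration_step {f g : ℤ → ℤ} (hf : StrictMono f) (hg : StrictMono g)
    (hfg : Set.range f = Set.range g) {k l : ℤ} (h : f k = g l) :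
    f (k + 1) = g (l + 1) ∧ f (k - 1) = g (l - 1) := by
  have key : ∀ {f g : ℤ → ℤ}, StrictMono f → StrictMono g → Set.range f = Set.range g →
      ∀ {k l : ℤ}, f k = g l → f (k + 1) ≤ g (l + 1) ∧ g (l - 1) ≤ f (k - 1) := by
    intro f g hf hg hfg k l h
    constructor
    · obtain ⟨j, hj⟩ : g (l + 1) ∈ Set.range f := hfg ▸ ⟨_, rfl⟩
      have : k < j := hf.lt_iff_lt.1 (by rw [h, hj]; exact hg (by omega))
      rw [← hj]; exact hf.monotone (by omega)
    · obtain ⟨j, hj⟩ : g (l - 1) ∈ Set.range f := hfg ▸ ⟨_, rfl⟩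
      have : j < k := hf.lt_iff_lt.1 (by rw [h, hj]; exact hg (by omega))
      rw [← hj]; exact hf.monotone (by omega)
  have h1 := key hf hg hfg h
  have h2 := key hg hf hfg.symm h.symm
  exact ⟨le_antisymm h1.1 h2.1, le_antisymm h2.2 h1.2⟩

/-- The increasing enumeration of a set of integers is unique. -/
theorem enumeration_unique {f g : ℤ → ℤ} (hf : StrictMono f) (hg : StrictMono g)
    (hfg : Set.range f = Set.range g) {m : ℤ} (hf0 : f 0 ≤ m) (hf1 : m < f 1) (hg0 : g 0 ≤ m)
    (hg1 : m < g 1) : f = g := by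
  have key : ∀ {f g : ℤ → ℤ}, StrictMono f → Set.range f = Set.range g → g 0 ≤ m → m < f 1 →
      g 0 ≤ f 0 := by
    intro f g hf hfg h0 h1
    obtain ⟨j, hj⟩ : g 0 ∈ Set.range f := hfg ▸ ⟨_, rfl⟩
    have : j < 1 := hf.lt_iff_lt.1 (by omega)
    rw [← hj]; exact hf.monotone (by omega)
  funext k
  induction k using Int.induction_on with
  | zero => exact le_antisymm (key hg hfg.symm hf0 hg1) (key hf hfg hg0 hf1)
  | succ k ih => exact (enumeration_step hf hg hfg ih).1
  | pred k ih => exact (enumeration_step hf hg hfg ih).2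

/-- A monotone sequence of bits is determined by a threshold. -/
theorem exists_threshold {u : ℤ → ℤ} {w : ℤ} (hw : 0 ≤ w)
    (h01 : ∀ a, 1 ≤ a → a ≤ w → u a = 0 ∨ u a = 1)
    (hu : ∀ a, 1 ≤ a → a < w → u a ≤ u (a + 1)) :
    ∃ P, -1 ≤ P ∧ P ≤ w - 1 ∧ ∀ a, 1 ≤ a → a ≤ w → u a = if P < a - 1 then 1 else 0 := by
  induction w, hw using Int.leInduction with
  | base => exact ⟨-1, by omega, by omega, fun a _ _ => by omega⟩
  | succ w hw ih =>
    obtain ⟨P, h1, h2, h3⟩ := ih (fun a h h' => h01 a h (by omega)) fun a h h' => hu a h (by omega)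
    rcases h01 (w + 1) (by omega) le_rfl with h | h
    · refine ⟨w, by omega, by omega, fun a ha ha' => ?_⟩
      rw [if_neg (by omega)]
      rcases eq_or_lt_of_le ha' with rfl | ha''
      · exact h
      · have hw1 := hu w (by omega) (by omega)
        have e1 := h3 w (by omega) le_rfl
        have e2 := h3 a ha (by omega)
        split_ifs at e1 e2 <;> omega
    · refine ⟨P, h1, by omega, fun a ha ha' => ?_⟩
      rcases eq_or_lt_of_le ha' with rfl | ha''
      · rw [if_pos (by omega), h]
      · exact h3 a ha (by omega)

/-! ### Stripes in tilings of the plane by loose tiles -/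

theorem Loose.isStripe {n : ℤ} {R T L B : Label} (h : Loose n R T L B) (hL : L.1 = 0)
    (hB : B.1 = 1) : IsStripe n R T L B := by
  simp only [Loose, IsWhite, IsStripe, IsJunction] at *; omega

theorem Loose.isJunction {n : ℤ} {R T L B : Label} (h : Loose n R T L B) (hL : L.1 = 0)
    (hB : B.1 = 0) : IsJunction n R T L B := by
  simp only [Loose, IsWhite, IsStripe, IsJunction] at *; omega

theorem IsLabel.fst {n : ℤ} {e : Label} (h : IsLabel n e) : e.1 = 0 ∨ e.1 = 1 := by
  unfold IsLabel at h; omega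

/-- `V i j` and `H i j` are the labels of the left and the bottom edges of a tiling by loose
tiles. -/
def LooseGrid (n : ℤ) (V H : ℤ → ℤ → Label) : Prop :=
  ∀ i j, Loose n (V (i + 1) j) (H i (j + 1)) (V i j) (H i j)

/-- `V i j` and `H i j` are the labels of the left and the bottom edges of a valid configuration. -/
def TightGrid (n : ℤ) (V H : ℤ → ℤ → Label) : Prop :=
  ∀ i j, Tight n (V (i + 1) j) (H i (j + 1)) (V i j) (H i j)

/-- `q` and `q'` are consecutive elements of `S`. -/
def IsGap (S : ℤ → Prop) (q q' : ℤ) : Prop :=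
  S q ∧ S q' ∧ q < q' ∧ ∀ t, q < t → t < q' → ¬ S t

/-- Row `j` is a horizontal stripe. -/
def RowStripe (V : ℤ → ℤ → Label) (j : ℤ) : Prop := (V 0 j).1 = 0

section Grid

variable {n : ℤ} {V H : ℤ → ℤ → Label}

theorem TightGrid.loose (h : TightGrid n V H) : LooseGrid n V H := fun i j => (h i j).loose

theorem TightGrid.hat (h : TightGrid n V H) :
    TightGrid n (fun i j => H j i) (fun i j => V j i) := fun i j => (h j i).hat

namespace LooseGrid

theorem hat (h : LooseGrid n V H) : LooseGrid n (fun i j => H j i) (fun i j => V j i) :=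
  fun i j => (h j i).hat

theorem fst_add_one (h : LooseGrid n V H) (i j : ℤ) : (V (i + 1) j).1 = (V i j).1 := by
  have := h i j
  simp only [Loose, IsWhite, IsStripe, IsJunction] at this; omega

theorem rowStripe_iff (h : LooseGrid n V H) (i j : ℤ) : (V i j).1 = 0 ↔ RowStripe V j := by
  unfold RowStripe
  induction i using Int.induction_on with
  | zero => rfl
  | succ i ih => rw [h.fst_add_one, ih]
  | pred i ih =>
    have := h.fst_add_one (-(i : ℤ) - 1) j
    rw [sub_add_cancel] at this
    rw [← ih, this]

theorem not_rowStripe_iff (hn : 1 ≤ n) (h : LooseGrid n V H) (i j : ℤ) :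
    (V i j).1 = 1 ↔ ¬ RowStripe V j := by
  rw [← h.rowStripe_iff i j]
  have := ((h i j).isLabel hn).2.2.1.fst
  omega

theorem colStripe_iff (h : LooseGrid n V H) (i j : ℤ) :
    (H i j).1 = 0 ↔ RowStripe (fun i j => H j i) i := h.hat.rowStripe_iff j i

theorem not_colStripe_iff (hn : 1 ≤ n) (h : LooseGrid n V H) (i j : ℤ) :
    (H i j).1 = 1 ↔ ¬ RowStripe (fun i j => H j i) i := h.hat.not_rowStripe_iff hn j i

/-- Outside horizontal stripes every tile, white or vertical stripe, raises the last coordinate by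
one from bottom to top. -/
theorem climb (hn : 1 ≤ n) (h : LooseGrid n V H) {q m : ℤ}
    (hq : ∀ t, q < t → t < m → ¬ RowStripe V t) (i : ℤ) {b : ℤ} (hb : 1 ≤ b) (hbm : b ≤ m - q) :
    (H i (q + b)).2.2 = (H i (q + 1)).2.2 + b - 1 := by
  induction b, hb using Int.leInduction with
  | base => omega
  | succ b hb ih =>
    have h1 := (h.not_rowStripe_iff hn i (q + b)).2 (hq _ (by omega) (by omega))
    have h2 := h i (q + b)
    rw [add_assoc] at h2
    have := ih (by omega)
    simp only [Loose, IsWhite, IsStripe, IsJunction] at h2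
    omega

/-- Without a stripe the last coordinate would climb by `n + 4`, but it always lies between 0 and `n
+ 1`. -/
theorem exists_rowStripe (hn : 1 ≤ n) (h : LooseGrid n V H) (j : ℤ) :
    ∃ s, RowStripe V s ∧ j < s ∧ s < j + n + 5 := by
  by_contra! hc
  have h1 := h.climb hn (q := j) (m := j + n + 5) (fun t h1 h2 h3 => absurd (hc t h3 h1) (by omega))
    0 (b := n + 5) (by omega) (by omega)
  have h2 := ((h 0 (j + (n + 5))).isLabel hn).2.2.2
  have h3 := ((h 0 (j + 1)).isLabel hn).2.2.2
  unfold IsLabel at h2 h3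
  omega

theorem exists_gap_above (hn : 1 ≤ n) (h : LooseGrid n V H) {q : ℤ} (hq : RowStripe V q) :
    ∃ q', IsGap (RowStripe V) q q' := by
  obtain ⟨s, hs, hqs, -⟩ := h.exists_rowStripe hn q
  obtain ⟨b, hb, hb'⟩ := Int.exists_least_of_bdd (P := fun s => RowStripe V s ∧ q < s)
    ⟨q, fun z hz => hz.2.le⟩ ⟨s, hs, hqs⟩
  exact ⟨b, hq, hb.1, hb.2, fun s h1 h2 h3 => absurd (hb' s ⟨h3, h1⟩) (not_le.2 h2)⟩

theorem exists_gap_below (hn : 1 ≤ n) (h : LooseGrid n V H) {q' : ℤ} (hq : RowStripe V q') :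
    ∃ q, IsGap (RowStripe V) q q' := by
  obtain ⟨s, hs, -, hqs⟩ := h.exists_rowStripe hn (q' - n - 5)
  obtain ⟨b, hb, hb'⟩ := Int.exists_greatest_of_bdd (P := fun s => RowStripe V s ∧ s < q')
    ⟨q', fun z hz => hz.2.le⟩ ⟨s, hs, by omega⟩
  exact ⟨b, hb.1, hq, hb.2, fun s h1 h2 h3 => absurd (hb' s ⟨h3, h2⟩) (not_le.2 h1)⟩

theorem gap_climb (hn : 1 ≤ n) (h : LooseGrid n V H) {q q' : ℤ} (hg : IsGap (RowStripe V) q q')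
    (i : ℤ) : (H i q').2.2 = (H i (q + 1)).2.2 + (q' - q) - 1 := by
  have h1 := hg.2.2.1
  have := h.climb hn hg.2.2.2 i (b := q' - q) (by omega) le_rfl
  rwa [add_sub_cancel] at this

/-- The last coordinate leaves the lower stripe at 1 plus its left bit and reaches the upper stripe
at `n` plus its right bit, so the climb measures the distance. -/
theorem gap_of_not_colStripe (hn : 1 ≤ n) (h : LooseGrid n V H) {q q' : ℤ}
    (hg : IsGap (RowStripe V) q q') {i : ℤ} (hi : ¬ RowStripe (fun i j => H j i) i) :
    q' - q = n + (V (i + 1) q').2.1 - (V i q).2.1 ∧ IsStripe n (V (i + 1) q) (H i (q + 1)) (V i q)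
      (H i q) ∧ IsStripe n (V (i + 1) q') (H i (q' + 1)) (V i q') (H i q') := by
  have h1 := h.gap_climb hn hg i
  have h2 := (h i q).isStripe ((h.rowStripe_iff _ _).2 hg.1) ((h.not_colStripe_iff hn _ _).2 hi)
  have h3 := (h i q').isStripe ((h.rowStripe_iff _ _).2 hg.2.1) ((h.not_colStripe_iff hn _ _).2 hi)
  refine ⟨?_, h2, h3⟩
  unfold IsStripe at h2 h3; omega

theorem gap_of_colStripe (hn : 1 ≤ n) (h : LooseGrid n V H) {q q' : ℤ}
    (hg : IsGap (RowStripe V) q q') {i : ℤ} (hi : RowStripe (fun i j => H j i) i) :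
    q' - q = n + 1 + (V (i + 1) q').2.1 - (H i (q + 1)).2.2 ∧
      IsJunction n (V (i + 1) q) (H i (q + 1)) (V i q) (H i q) ∧
      IsJunction n (V (i + 1) q') (H i (q' + 1)) (V i q') (H i q') := by
  have h1 := h.gap_climb hn hg i
  have h2 := (h i q).isJunction ((h.rowStripe_iff _ _).2 hg.1) ((h.colStripe_iff _ _).2 hi)
  have h3 := (h i q').isJunction ((h.rowStripe_iff _ _).2 hg.2.1) ((h.colStripe_iff _ _).2 hi)
  refine ⟨?_, h2, h3⟩
  unfold IsJunction at h2 h3; omega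

/-- The distance of consecutive stripes is `n` or `n + 1`. -/
theorem gap_eq (hn : 1 ≤ n) (h : LooseGrid n V H) {q q' : ℤ} (hg : IsGap (RowStripe V) q q') :
    q' - q = n ∨ q' - q = n + 1 := by
  obtain ⟨c, hc, -⟩ := h.hat.exists_rowStripe hn 0
  obtain ⟨g, j1, j2⟩ := h.gap_of_colStripe hn hg hc
  by_contra hne
  -- A single vertical stripe bounds the distance between `n` and `n + 2`. The excess value excludes
  -- any column that is not a stripe.
  have hq : q' - q = n + 2 := by unfold IsJunction at j1 j2; omega
  have hcol : ∀ i, RowStripe (fun i j => H j i) i := fun i => by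
    by_contra hi
    obtain ⟨g, j1, j2⟩ := h.gap_of_not_colStripe hn hg hi
    unfold IsStripe at j1 j2; omega
  obtain ⟨g', j1', j2'⟩ := h.gap_of_colStripe hn hg (hcol (c + 1))
  -- Adjacent junctions share a label whose last coordinate is at most 1 on one side and at least
  -- `n` on the other.
  have hn1 : n = 1 := by unfold IsJunction at j2 j2'; omega
  have hrow : ∀ i t, q < t → t < q' → (V i t).1 = 1 := fun i t h1 h2 =>
    (h.not_rowStripe_iff hn _ _).2 (hg.2.2.2 t h1 h2)
  have s : ∀ i b, 1 ≤ b → b ≤ 2 →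
      IsStripe n (H i (q + b + 1)) (V (i + 1) (q + b)) (H i (q + b)) (V i (q + b)) :=
    fun i b h1 h2 => (h i (q + b)).hat.isStripe ((h.colStripe_iff _ _).2 (hcol i))
      (hrow _ _ (by omega) (by omega))
  have s1 := s c 1 le_rfl (by omega)
  have s2 := s c 2 (by omega) (by omega)
  have s3 := s (c + 1) 1 le_rfl (by omega)
  have s4 := s (c + 1) 2 (by omega) (by omega)
  have s6 := s (c + 1 + 1) 2 (by omega) (by omega)
  have e : q + 2 + 1 = q' := by omega
  have e' : q + 1 + 1 = q + 2 := by omega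
  rw [e] at s2 s4 s6
  rw [e'] at s1 s3
  -- Middle bits of vertical stripes pass up and to the right. The bit 0 above the junction of
  -- column `c` thus reaches the junction of column `c + 1 + 1` in row `q'`, which requires the bit
  -- 1.
  obtain ⟨g'', j1'', j2''⟩ := h.gap_of_colStripe hn hg (hcol (c + 1 + 1))
  clear hrow s hcol
  simp only [IsStripe, IsJunction] at *
  omega

/-- Right bit 0 makes the distance to the stripe below minimal, equal to `n`. In column `i - 1` the
upper right bit is 1; a junction there would make the distance larger, and a stripe tile keeps it at
`n` only with lower left bit 1. -/
theorem antigreen_step (hn : 1 ≤ n) (h : LooseGrid n V H) {i j : ℤ}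
    (hA : RowStripe V j ∧ ¬ RowStripe (fun i j => H j i) i ∧ (V i j).2.1 = 1 ∧
      (V (i + 1) j).2.1 = 0) :
    RowStripe V (j - n) ∧ ¬ RowStripe (fun i j => H j i) (i - 1) ∧ (V (i - 1) (j - n)).2.1 = 1 ∧
      (V (i - 1 + 1) (j - n)).2.1 = 0 := by
  obtain ⟨hj, hi, hl, hr⟩ := hA
  obtain ⟨q, hg⟩ := h.exists_gap_below hn hj
  obtain ⟨g, j1, j2⟩ := h.gap_of_not_colStripe hn hg hi
  have g0 := h.gap_eq hn hg
  have hq : q = j - n := by unfold IsStripe at j1 j2; omega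
  subst hq
  by_cases hi' : RowStripe (fun i j => H j i) (i - 1)
  · obtain ⟨g', j1', j2'⟩ := h.gap_of_colStripe hn hg hi'
    rw [sub_add_cancel] at g' j1' j2'
    unfold IsJunction at j1' j2'; omega
  · obtain ⟨g', j1', j2'⟩ := h.gap_of_not_colStripe hn hg hi'
    rw [sub_add_cancel] at g' j1' j2'
    refine ⟨hg.1, hi', ?_, ?_⟩
    · omega
    · rw [sub_add_cancel]; omega

theorem not_antigreen (hn : 1 ≤ n) (h : LooseGrid n V H) {i j : ℤ} (hL : (V i j).1 = 0)
    (hB : (H i j).1 = 1) : (V i j).2.1 ≤ (V (i + 1) j).2.1 := by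
  by_contra hlt
  have h0 := (h i j).isStripe hL hB
  have key : ∀ m : ℕ, ∃ j, RowStripe V j ∧ ¬ RowStripe (fun i j => H j i) (i - m) ∧
      (V (i - m) j).2.1 = 1 ∧ (V (i - m + 1) j).2.1 = 0 := fun m => by
    induction m with
    | zero =>
      refine ⟨j, (h.rowStripe_iff _ _).1 hL, ?_⟩
      simp only [Nat.cast_zero, sub_zero]
      refine ⟨(h.not_colStripe_iff hn _ _).1 hB, ?_⟩
      unfold IsStripe at h0; omega
    | succ m ih =>
      obtain ⟨j, hj⟩ := ih
      have := h.antigreen_step hn hj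
      rw [sub_sub] at this
      exact ⟨_, by exact_mod_cast this⟩
  -- Some vertical stripe lies to the left of column `i`, and the diagonal of antigreen tiles would
  -- have to cross it.
  obtain ⟨s, hs, -, hs'⟩ := h.hat.exists_rowStripe hn (i - n - 5)
  obtain ⟨j, -, hj, -⟩ := key (i - s).toNat
  rw [Int.toNat_of_nonneg (by omega), sub_sub_cancel] at hj
  exact hj hs

/-- Top bit 0 forces the distance to the next stripe above to be `n + 1`, while right bit 1 limits
it to `n` as measured in column `i + 1`, unless that column is a stripe too. Adjacent stripes occur
only for `n = 1` and are refuted directly. The other forbidden junction is the mirror image. -/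
theorem not_bad_junction (hn : 1 ≤ n) (h : LooseGrid n V H) {i j : ℤ} (hL : (V i j).1 = 0)
    (hB : (H i j).1 = 0) : ¬((V (i + 1) j).2.1 = 1 ∧ (H i (j + 1)).2.2 = 0) := by
  intro hbad
  have hj := (h.rowStripe_iff _ _).1 hL
  obtain ⟨q', hg⟩ := h.exists_gap_above hn hj
  obtain ⟨g, j1, j2⟩ := h.gap_of_colStripe hn hg ((h.colStripe_iff _ _).1 hB)
  have g0 := h.gap_eq hn hg
  by_cases hi : RowStripe (fun i j => H j i) (i + 1)
  · obtain ⟨g', j1', j2'⟩ := h.gap_of_colStripe hn hg hi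
    have hn1 : n = 1 := by unfold IsJunction at j1 j1'; omega
    have e : j + 1 + 1 = q' := by unfold IsJunction at j1 j1' j2; omega
    have hV : ∀ i, (V i (j + 1)).1 = 1 := fun i =>
      (h.not_rowStripe_iff hn _ _).2 (hg.2.2.2 _ (by omega) (by omega))
    have s1 := (h i (j + 1)).hat.isStripe j1.2.2.2.1 (hV _)
    have s2 := (h (i + 1) (j + 1)).hat.isStripe j1'.2.2.2.1 (hV _)
    rw [e] at s1 s2
    simp only [IsStripe, IsJunction] at *
    omega
  · obtain ⟨g', j1', j2'⟩ := h.gap_of_not_colStripe hn hg hi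
    simp only [IsStripe, IsJunction] at *
    omega

/-- Antigreen tiles and forbidden junctions do not occur in tilings of the plane. -/
theorem tight (hn : 1 ≤ n) (h : LooseGrid n V H) : TightGrid n V H := by
  intro i j
  rcases h i j with t | t | t | t
  · exact .inl t
  · exact .inr (.inl ⟨t, h.not_antigreen hn t.1 t.2.2.1⟩)
  · exact .inr (.inr (.inl ⟨t, h.hat.not_antigreen hn t.1 t.2.2.1⟩))
  · exact .inr (.inr (.inr ⟨t, h.not_bad_junction hn t.1 t.2.2.1,
      fun k => h.hat.not_bad_junction hn t.2.2.1 t.1 k.symm⟩))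

end LooseGrid

/-! ### Cutting a valid configuration into blocks -/

theorem label_eq {e : Label} {a b c : ℤ} (h1 : e.1 = a) (h2 : e.2.1 = b) (h3 : e.2.2 = c) :
    e = (a, b, c) := Prod.ext h1 (Prod.ext h2 h3)

namespace TightGrid

/-- The piece of a horizontal stripe between two vertical stripes is the bottom row of a block. -/
theorem exists_segment (hn : 1 ≤ n) (h : TightGrid n V H) {p p' q : ℤ}
    (hp : IsGap (RowStripe fun i j => H j i) p p') (hq : RowStripe V q) :
    ∃ e, IsLabel n e ∧ width n e = p' - p ∧
      (∀ f a, 0 ≤ a → a < p' - p → H (p + a) q = edge n e f a 0) ∧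
      (∀ f a, 0 ≤ a → a < p' - p → H (p + a) (q + 1) = edge n e f a 1 ∨ a = 0) ∧
      (∀ f a, 1 ≤ a → a ≤ p' - p → V (p + a) q = edge n f e 0 a) := by
  have hl := h.loose
  have hw := hl.hat.gap_eq hn hp
  have hV : ∀ i, (V i q).1 = 0 := fun i => (hl.rowStripe_iff _ _).2 hq
  have jp := (hl p q).isJunction (hV _) ((hl.colStripe_iff _ _).2 hp.1)
  have jp' := (hl p' q).isJunction (hV _) ((hl.colStripe_iff _ _).2 hp.2.1)
  have st : ∀ a, 1 ≤ a → a < p' - p →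
      IsStripe n (V (p + a + 1) q) (H (p + a) (q + 1)) (V (p + a) q) (H (p + a) q) :=
    fun a h1 h2 => (hl _ _).isStripe (hV _) ((hl.not_colStripe_iff hn _ _).2
      (hp.2.2.2 _ (by omega) (by omega)))
  have hthird : ∀ a, 1 ≤ a → a ≤ p' - p → (V (p + a) q).2.2 = (V (p + 1) q).2.2 + a - 1 := by
    intro a ha
    induction a, ha using Int.leInduction with
    | base => intro; omega
    | succ a ha ih =>
      intro h'
      have h1 := st a ha (by omega)
      have h2 := ih (by omega)
      rw [← add_assoc]
      unfold IsStripe at h1; omega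
  have hp0 := hp.2.2.1
  have hend := hthird (p' - p) (by omega) le_rfl
  rw [add_sub_cancel] at hend
  -- Absence of antigreen tiles makes the middle bits monotone along the stripe.
  obtain ⟨P, hP1, hP2, hP⟩ := exists_threshold (u := fun a => (V (p + a) q).2.1) (w := p' - p)
    (by omega) (fun a h1 h2 => by
      rcases eq_or_lt_of_le h1 with rfl | h3
      · unfold IsJunction at jp; omega
      · have := st (a - 1) (by omega) (by omega)
        rw [show p + (a - 1) + 1 = p + a by omega] at this
        unfold IsStripe at this; omega) (fun a h1 h2 => by
      have h3 := st a h1 h2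
      have := hl.not_antigreen hn h3.1 h3.2.2.1
      rwa [add_assoc] at this)
  have hP1' := hP 1 le_rfl (by omega)
  have hPw := hP (p' - p) (by omega) le_rfl
  rw [add_sub_cancel] at hPw
  obtain ⟨e, he, hew, heP, heL⟩ : ∃ e, IsLabel n e ∧ width n e = p' - p ∧ greenPos e = P ∧
      startIndex e = (V (p + 1) q).2.2 := by
    unfold IsJunction at jp jp'
    simp only [IsLabel, width, greenPos, startIndex]
    rcases hw with hw | hw
    -- The label solves `greenPos e = P` and `startIndex e = (V (p + 1) q).2.2`, with first
    -- coordinate 1 for width `n` and 0 for width `n + 1`.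
    · refine ⟨(1, 1, P + 2), ?_⟩
      dsimp only
      split_ifs at hP1' hPw <;> omega
    · refine ⟨(0, 1 - (V (p + 1) q).2.2, P + 1), ?_⟩
      dsimp only
      split_ifs at hP1' hPw <;> omega
  refine ⟨e, he, hew, fun f a h1 h2 => ?_, fun f a h1 h2 => ?_, fun f a h1 h2 => ?_⟩
  · by_cases ha : a = 0
    · subst ha
      unfold IsJunction at jp
      simp only [edge, if_true, heL, startBit, heP, add_zero]
      refine label_eq (by omega) (by omega) ?_
      split_ifs at hP1' ⊢ <;> omega
    · have h3 := st a (by omega) h2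
      have h4 := hP (a + 1) (by omega) (by omega)
      rw [← add_assoc] at h4
      simp only [edge, ha, if_true, if_false, heP]
      unfold IsStripe at h3
      refine label_eq (by omega) (by omega) ?_
      split_ifs at h4 ⊢ <;> omega
  · by_cases ha : a = 0
    · exact .inr ha
    · left
      have h3 := st a (by omega) h2
      have h4 := hP a (by omega) (by omega)
      simp only [edge, ha, one_ne_zero, if_false, heP]
      unfold IsStripe at h3
      refine label_eq (by omega) (by omega) ?_
      split_ifs at h4 ⊢ <;> omega
  · have h3 := hthird a h1 h2
    have h4 := hP a h1 h2
    have ha : a ≠ 0 := by omega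
    simp only [edge, ha, if_true, if_false, heP, heL]
    exact label_eq (hV _) h4 h3

/-- The part of a valid configuration between consecutive stripes is a block. -/
theorem edge_eq (hn : 1 ≤ n) (h : TightGrid n V H) {p p' q q' : ℤ} {e f : Label}
    (hp : IsGap (RowStripe fun i j => H j i) p p') (hq : IsGap (RowStripe V) q q')
    (he0 : ∀ f a, 0 ≤ a → a < p' - p → H (p + a) q = edge n e f a 0)
    (he1 : ∀ f a, 0 ≤ a → a < p' - p → H (p + a) (q + 1) = edge n e f a 1 ∨ a = 0)
    (hf : ∀ e b, 1 ≤ b → b ≤ q' - q → H p (q + b) = edge n e f 0 b)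
    {a b : ℤ} (ha : 0 ≤ a) (ha' : a < p' - p) (hb : 0 ≤ b) (hb' : b ≤ q' - q) :
    H (p + a) (q + b) = edge n e f a b := by
  have hl := h.loose
  by_cases hb0 : b = 0
  · subst hb0; rw [add_zero]; exact he0 f a ha ha'
  by_cases ha0 : a = 0
  · subst ha0; rw [add_zero]; exact hf e b (by omega) hb'
  have h1 := (he1 f a ha ha').resolve_right ha0
  -- Off the stripes, the row just above the horizontal stripe determines the whole column by
  -- climbing.
  have h2 := hl.climb hn hq.2.2.2 (p + a) (b := b) (by omega) hb'
  have h3 : ∀ t, (H (p + a) t).1 = 1 := fun t =>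
    (hl.not_colStripe_iff hn _ _).2 (hp.2.2.2 _ (by omega) (by omega))
  have h4 := ((hl (p + a) (q + b)).isLabel hn).2.2.2
  rw [h1] at h2
  simp only [edge, ha0, hb0, one_ne_zero, if_false] at h2 ⊢
  have h3' := h3 (q + b)
  refine label_eq h3' ?_ ?_
  · unfold IsLabel at h4; omega
  · omega

/-- Every valid configuration consists of the blocks of a valid configuration. -/
theorem exists_blocks (hn : 1 ≤ n) (h : TightGrid n V H) :
    ∃ (p q : ℤ → ℤ) (F E : ℤ → ℤ → Label), TightGrid n F E ∧
      (∀ k l, p (k + 1) = p k + width n (E k l)) ∧ (∀ k l, q (l + 1) = q l + width n (F k l)) ∧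
      (∀ k l a b, 0 ≤ a → a < width n (E k l) → 0 ≤ b → b ≤ width n (F k l) →
        H (p k + a) (q l + b) = edge n (E k l) (F k l) a b) ∧
      (∀ k l a b, 0 ≤ a → a ≤ width n (E k l) → 0 ≤ b → b < width n (F k l) →
        V (p k + a) (q l + b) = edge n (F k l) (E k l) b a) := by
  have hl := h.loose
  have enum : ∀ {V H : ℤ → ℤ → Label}, LooseGrid n V H →
      ∃ q : ℤ → ℤ, ∀ l, IsGap (RowStripe V) (q l) (q (l + 1)) := fun {V H} hl => by
    obtain ⟨q, h1, h2, h3⟩ := exists_enumeration (S := {j | RowStripe V j})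
      (fun m => by obtain ⟨s, hs, hs', -⟩ := hl.exists_rowStripe hn m; exact ⟨s, hs, hs'⟩)
      (fun m => by
        obtain ⟨s, hs, -, hs'⟩ := hl.exists_rowStripe hn (m - n - 5); exact ⟨s, hs, by omega⟩)
    exact ⟨q, fun l => ⟨h1 l, h1 (l + 1), h2 l, fun t => h3 l t⟩⟩
  obtain ⟨q, hq⟩ := enum hl
  obtain ⟨p, hp⟩ := enum hl.hat
  choose E hE hEw hE0 hE1 hEV using fun k l => h.exists_segment hn (hp k) (hq l).1
  choose F hF hFw hF0 hF1 hFV using fun k l => h.hat.exists_segment hn (hq l) (hp k).1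
  have hH : ∀ k l a b, 0 ≤ a → a < width n (E k l) → 0 ≤ b → b ≤ width n (F k l) →
      H (p k + a) (q l + b) = edge n (E k l) (F k l) a b := fun k l a b h1 h2 h3 h4 =>
    h.edge_eq hn (hp k) (hq l) (hE0 k l) (hE1 k l) (hFV k l) h1 (by rwa [← hEw k l]) h3
      (by rwa [← hFw k l])
  have hV : ∀ k l a b, 0 ≤ a → a ≤ width n (E k l) → 0 ≤ b → b < width n (F k l) →
      V (p k + a) (q l + b) = edge n (F k l) (E k l) b a := fun k l a b h1 h2 h3 h4 =>
    h.hat.edge_eq hn (hq l) (hp k) (hF0 k l) (hF1 k l) (hEV k l) h3 (by rwa [← hFw k l]) h1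
      (by rwa [← hEw k l])
  have hp1 : ∀ k l, p (k + 1) = p k + width n (E k l) := fun k l => by rw [hEw]; ring
  have hq1 : ∀ k l, q (l + 1) = q l + width n (F k l) := fun k l => by rw [hFw]; ring
  have hEfst : ∀ k l l', (E k l).1 = (E k l').1 := fun k l l' => by
    have h1 := hEw k l; have h2 := hEw k l'; unfold width at h1 h2; omega
  have hFfst : ∀ k k' l, (F k l).1 = (F k' l).1 := fun k k' l => by
    have h1 := hFw k l; have h2 := hFw k' l; unfold width at h1 h2; omega
  have hpos : ∀ e, IsLabel n e → 0 ≤ width n e := fun e he => by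
    unfold IsLabel at he; unfold width; omega
  have hpos' : ∀ k l, 0 < width n (E k l) ∧ 0 < width n (F k l) := fun k l => by
    have h1 := (hp k).2.2.1
    have h2 := (hq l).2.2.1
    rw [hEw, hFw]; omega
  refine ⟨p, q, F, E, LooseGrid.tight hn fun k l => ?_, hp1, hq1, hH, hV⟩
  -- The top boundary of a block is also the bottom boundary of the block above, and similarly to
  -- the right; the two readings of the same edges are the hypotheses on `edge`.
  refine Loose.of_edge (f := F k (l + 1)) (g := E (k + 1) l) hn (hF _ _) (hE _ _) (hF _ _) (hE _ _)
    (hEfst _ _ _) (hFfst _ _ _) (fun a h1 h2 => ?_) fun b h1 h2 => ?_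
  · rw [← hH k l a _ h1 h2 (hpos _ (hF _ _)) le_rfl, ← hq1 k l,
      ← hH k (l + 1) a 0 h1 (by simpa [width, hEfst k (l + 1) l] using h2) le_rfl
        (hpos _ (hF _ _)), add_zero]
  · rw [← hV k l _ b (hpos _ (hE _ _)) le_rfl h1 h2, ← hp1 k l,
      ← hV (k + 1) l 0 b le_rfl (hpos _ (hE _ _)) h1
        (by simpa [width, hFfst (k + 1) k l] using h2), add_zero]

end TightGrid

end Grid

/-! ### The substitution and concatenation of blocks -/

/-- The tile at position `(a, b)` in the block of the tile `t`. -/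
def blockTile (n : ℤ) (t : WangTile Label) (a b : ℤ) : WangTile Label :=
  ⟨edge n t.left t.bottom b (a + 1), edge n t.bottom t.left a (b + 1),
    edge n t.left t.bottom b a, edge n t.bottom t.left a b⟩

variable {n : ℕ}

theorem tight_of_mem (t : tiles n) : Tight n t.1.right t.1.top t.1.left t.1.bottom :=
  (mem_tiles_iff _).1 t.2

theorem width_pos (hn : 1 ≤ n) (t : tiles n) :
    0 < width n t.1.bottom ∧ 0 < width n t.1.left := by
  have h := (tight_of_mem t).loose.isLabel (by exact_mod_cast hn)
  simp only [IsLabel, width] at *; omega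

theorem blockTile_mem (hn : 1 ≤ n) (t : tiles n) {a b : ℤ} (ha : 0 ≤ a)
    (ha' : a < width n t.1.bottom) (hb : 0 ≤ b) (hb' : b < width n t.1.left) :
    blockTile n t.1 a b ∈ tiles n :=
  (mem_tiles_iff _).2 ((tight_of_mem t).edge (by exact_mod_cast hn) ha ha' hb hb')

theorem blockTile_right (hn : 1 ≤ n) {t t' : tiles n} (h : t.1.right = t'.1.left) {b : ℤ}
    (hb : 0 ≤ b) (hb' : b < width n t.1.left) :
    (blockTile n t.1 (width n t.1.bottom - 1) b).right = (blockTile n t'.1 0 b).left := by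
  simp only [blockTile, sub_add_cancel]
  rw [(tight_of_mem t).hat.edge_top (by exact_mod_cast hn) t'.1.bottom hb hb', h]

theorem blockTile_top (hn : 1 ≤ n) {t t' : tiles n} (h : t.1.top = t'.1.bottom) {a : ℤ}
    (ha : 0 ≤ a) (ha' : a < width n t.1.bottom) :
    (blockTile n t.1 a (width n t.1.left - 1)).top = (blockTile n t'.1 a 0).bottom := by
  simp only [blockTile, sub_add_cancel]
  rw [(tight_of_mem t).edge_top (by exact_mod_cast hn) t'.1.left ha ha', h]

theorem width_right (t : tiles n) : width n t.1.right = width n t.1.left := by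
  have h := (tight_of_mem t).loose
  simp only [Loose, IsWhite, IsStripe, IsJunction, width] at *; omega

theorem width_top (t : tiles n) : width n t.1.top = width n t.1.bottom := by
  have h := (tight_of_mem t).loose
  simp only [Loose, IsWhite, IsStripe, IsJunction, width] at *; omega

/-- The substitution that maps a tile to its block. -/
def rule (n : ℕ) (hn : 1 ≤ n) (t : tiles n) : Word (tiles n) where
  width := (width n t.1.bottom).toNat
  height := (width n t.1.left).toNat
  get a b := ⟨blockTile n t.1 (a : ℕ) (b : ℕ), blockTile_mem hn t (by omega)
    (by have := a.isLt; omega) (by omega) (by have := b.isLt; omega)⟩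

theorem rule_width (hn : 1 ≤ n) (t : tiles n) : ((rule n hn t).width : ℤ) = width n t.1.bottom :=
  Int.toNat_of_nonneg (width_pos hn t).1.le

theorem rule_height (hn : 1 ≤ n) (t : tiles n) : ((rule n hn t).height : ℤ) = width n t.1.left :=
  Int.toNat_of_nonneg (width_pos hn t).2.le

/-- A block partition of the columns and rows carries the concatenation of the blocks of the tiles
of `x` in the region `I × J`, and neighboring blocks match. -/
theorem exists_concat (hn : 1 ≤ n) (x : Config (tiles n)) {p q : ℤ → ℤ}
    (hp : ∀ k, p k < p (k + 1)) (hq : ∀ l, q l < q (l + 1)) {I J : Set ℤ}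
    (hw : ∀ k ∈ I, ∀ l ∈ J, p (k + 1) = p k + width n (x (k, l)).1.bottom)
    (hh : ∀ k ∈ I, ∀ l ∈ J, q (l + 1) = q l + width n (x (k, l)).1.left)
    (hR : ∀ k ∈ I, ∀ l ∈ J, k + 1 ∈ I → (x (k, l)).1.right = (x (k + 1, l)).1.left)
    (hT : ∀ k ∈ I, ∀ l ∈ J, l + 1 ∈ J → (x (k, l)).1.top = (x (k, l + 1)).1.bottom) :
    ∃ y : Config (tiles n),
      (∀ k ∈ I, ∀ l ∈ J, ∀ a b, 0 ≤ a → a < width n (x (k, l)).1.bottom → 0 ≤ b →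
        b < width n (x (k, l)).1.left → (y (p k + a, q l + b)).1 = blockTile n (x (k, l)).1 a b) ∧
      ∀ k ∈ I, ∀ l ∈ J, ∀ i j, p k ≤ i → i < p (k + 1) → q l ≤ j → j < q (l + 1) →
        ((i + 1 < p (k + 1) ∨ k + 1 ∈ I) → (y (i, j)).1.right = (y (i + 1, j)).1.left) ∧
        ((j + 1 < q (l + 1) ∨ l + 1 ∈ J) → (y (i, j)).1.top = (y (i, j + 1)).1.bottom) := by
  classical
  choose κ hκ hκ' using exists_le_lt_add_one hp
  choose μ hμ hμ' using exists_le_lt_add_one hq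
  -- A region `I × J` covers both the whole plane and finite patches. The fallback value `x m` is
  -- never used over the region, where the block sizes agree with `p` and `q`.
  let y : Config (tiles n) := fun m =>
    if h : m.1 - p (κ m.1) < width n (x (κ m.1, μ m.2)).1.bottom ∧
      m.2 - q (μ m.2) < width n (x (κ m.1, μ m.2)).1.left
    then ⟨_, blockTile_mem hn (x (κ m.1, μ m.2)) (sub_nonneg.2 (hκ m.1)) h.1
      (sub_nonneg.2 (hμ m.2)) h.2⟩
    else x m
  have hy : ∀ k ∈ I, ∀ l ∈ J, ∀ a b, 0 ≤ a → a < width n (x (k, l)).1.bottom → 0 ≤ b →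
      b < width n (x (k, l)).1.left →
      (y (p k + a, q l + b)).1 = blockTile n (x (k, l)).1 a b := by
    intro k hk l hl a b ha ha' hb hb'
    have e1 : κ (p k + a) = k := eq_of_le_lt_add_one hp (hκ _) (hκ' _) (by omega)
      (by rw [hw k hk l hl]; omega)
    have e2 : μ (q l + b) = l := eq_of_le_lt_add_one hq (hμ _) (hμ' _) (by omega)
      (by rw [hh k hk l hl]; omega)
    simp only [y]
    rw [dif_pos (by rw [e1, e2]; constructor <;> omega)]
    simp only [e1, e2, add_sub_cancel_left]
  refine ⟨y, hy, fun k hk l hl i j hi hi' hj hj' => ⟨fun h => ?_, fun h => ?_⟩⟩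
  · obtain ⟨a, rfl⟩ : ∃ a, i = p k + a := ⟨i - p k, by ring⟩
    obtain ⟨b, rfl⟩ : ∃ b, j = q l + b := ⟨j - q l, by ring⟩
    rw [hw k hk l hl] at hi'
    rw [hh k hk l hl] at hj'
    rw [hy k hk l hl a b (by omega) (by omega) (by omega) (by omega)]
    by_cases hi1 : p k + a + 1 < p (k + 1)
    · rw [hw k hk l hl] at hi1
      rw [add_assoc, hy k hk l hl (a + 1) b (by omega) (by omega) (by omega) (by omega)]
      rfl
    · have hk1 := h.resolve_left hi1
      rw [hw k hk l hl] at hi1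
      obtain rfl : a = width n (x (k, l)).1.bottom - 1 := by omega
      have e : p k + (width n (x (k, l)).1.bottom - 1) + 1 = p (k + 1) + 0 := by
        rw [hw k hk l hl]; ring
      have hR' := hR k hk l hl hk1
      rw [e, hy (k + 1) hk1 l hl 0 b le_rfl (width_pos hn _).1 (by omega)
        (by rw [← hR', width_right]; omega)]
      exact blockTile_right hn hR' (by omega) (by omega)
  · obtain ⟨a, rfl⟩ : ∃ a, i = p k + a := ⟨i - p k, by ring⟩
    obtain ⟨b, rfl⟩ : ∃ b, j = q l + b := ⟨j - q l, by ring⟩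
    rw [hw k hk l hl] at hi'
    rw [hh k hk l hl] at hj'
    rw [hy k hk l hl a b (by omega) (by omega) (by omega) (by omega)]
    by_cases hj1 : q l + b + 1 < q (l + 1)
    · rw [hh k hk l hl] at hj1
      rw [add_assoc, hy k hk l hl a (b + 1) (by omega) (by omega) (by omega) (by omega)]
      rfl
    · have hl1 := h.resolve_left hj1
      rw [hh k hk l hl] at hj1
      obtain rfl : b = width n (x (k, l)).1.left - 1 := by omega
      have e : q l + (width n (x (k, l)).1.left - 1) + 1 = q (l + 1) + 0 := by
        rw [hh k hk l hl]; ring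
      have hT' := hT k hk l hl hl1
      rw [e, hy k hk (l + 1) hl1 a 0 (by omega) (by rw [← hT', width_top]; omega) le_rfl
        (width_pos hn _).2]
      exact blockTile_top hn hT' (by omega) (by omega)

/-! ### Configurations -/

theorem tightGrid_of_mem {x : Config (tiles n)} (hx : x ∈ Omega n) :
    TightGrid n (fun i j => (x (i, j)).1.left) (fun i j => (x (i, j)).1.bottom) := fun i j => by
  have := tight_of_mem (x (i, j))
  rwa [(hx i j).1, (hx i j).2] at this

theorem width_bottom_eq {x : Config (tiles n)} (hx : x ∈ Omega n) (k l l' : ℤ) :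
    width n (x (k, l)).1.bottom = width n (x (k, l')).1.bottom := by
  have h1 : ∀ l, width n (x (k, l + 1)).1.bottom = width n (x (k, l)).1.bottom := fun l => by
    rw [← (hx k l).2, width_top]
  have h2 : ∀ l, width n (x (k, l)).1.bottom = width n (x (k, 0)).1.bottom := fun l => by
    induction l using Int.induction_on with
    | zero => rfl
    | succ l ih => rw [h1, ih]
    | pred l ih => rw [← ih, ← h1, sub_add_cancel]
  rw [h2 l, h2 l']

theorem width_left_eq {x : Config (tiles n)} (hx : x ∈ Omega n) (k k' l : ℤ) :
    width n (x (k, l)).1.left = width n (x (k', l)).1.left := by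
  have h1 : ∀ k, width n (x (k + 1, l)).1.left = width n (x (k, l)).1.left := fun k => by
    rw [← (hx k l).1, width_right]
  have h2 : ∀ k, width n (x (k, l)).1.left = width n (x (0, l)).1.left := fun k => by
    induction k using Int.induction_on with
    | zero => rfl
    | succ k ih => rw [h1, ih]
    | pred k ih => rw [← ih, ← h1, sub_add_cancel]
  rw [h2 k, h2 k']

theorem exists_configImage (hn : 1 ≤ n) {x : Config (tiles n)} (hx : x ∈ Omega n) :
    ∃ y ∈ Omega n, IsConfigImage (rule n hn) x y := by
  obtain ⟨p, p0, hp⟩ := exists_partialSums fun k => width n (x (k, 0)).1.bottom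
  obtain ⟨q, q0, hq⟩ := exists_partialSums fun l => width n (x (0, l)).1.left
  have hp1 : ∀ k, p k < p (k + 1) := fun k => by rw [hp]; have := (width_pos hn (x (k, 0))).1; omega
  have hq1 : ∀ k, q k < q (k + 1) := fun k => by rw [hq]; have := (width_pos hn (x (0, k))).2; omega
  have hp2 : ∀ k l, p (k + 1) = p k + width n (x (k, l)).1.bottom := fun k l => by
    rw [hp, width_bottom_eq hx k l 0]
  have hq2 : ∀ k l, q (l + 1) = q l + width n (x (k, l)).1.left := fun k l => by
    rw [hq, width_left_eq hx k 0 l]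
  obtain ⟨y, hy, hy'⟩ := exists_concat hn x hp1 hq1 (I := Set.univ) (J := Set.univ)
    (fun k _ l _ => hp2 k l) (fun k _ l _ => hq2 k l) (fun k _ l _ _ => (hx k l).1)
    (fun k _ l _ _ => (hx k l).2)
  refine ⟨y, fun i j => ?_, p, q, p0, q0, fun k l => ?_, fun k l => ?_,
    exists_le_lt_add_one hp1, exists_le_lt_add_one hq1, fun k l a b => Subtype.ext ?_⟩
  · obtain ⟨k, hk, hk'⟩ := exists_le_lt_add_one hp1 i
    obtain ⟨l, hl, hl'⟩ := exists_le_lt_add_one hq1 j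
    have := hy' k trivial l trivial i j hk hk' hl hl'
    exact ⟨this.1 (.inr trivial), this.2 (.inr trivial)⟩
  · rw [rule_width]; exact hp2 k l
  · rw [rule_height]; exact hq2 k l
  · have ha := a.isLt; have hb := b.isLt
    rw [← Int.ofNat_lt, rule_width] at ha
    rw [← Int.ofNat_lt, rule_height] at hb
    exact hy k trivial l trivial a b (by omega) ha (by omega) hb

end MetallicMean

/-! ### Surjectivity up to a shift and recognizability -/

/-- The image of a configuration under a morphism is unique. -/
theorem IsConfigImage.unique {A B : Type*} {ω : A → Word B} {x : Config A} {y y' : Config B}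
    (h : IsConfigImage ω x y) (h' : IsConfigImage ω x y') : y = y' := by
  obtain ⟨p, q, p0, q0, hp, hq, hpc, hqc, hy⟩ := h
  obtain ⟨p', q', p0', q0', hp', hq', -, -, hy'⟩ := h'
  obtain rfl : p = p' := MetallicMean.eq_partialSums (p0.trans p0'.symm) (fun k => hp k 0)
    fun k => hp' k 0
  obtain rfl : q = q' := MetallicMean.eq_partialSums (q0.trans q0'.symm) (fun k => hq 0 k)
    fun k => hq' 0 k
  funext m
  obtain ⟨k, hk, hk'⟩ := hpc m.1
  obtain ⟨l, hl, hl'⟩ := hqc m.2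
  rw [hp k l] at hk'
  rw [hq k l] at hl'
  have h1 := hy k l ⟨(m.1 - p k).toNat, by omega⟩ ⟨(m.2 - q l).toNat, by omega⟩
  have h2 := hy' k l ⟨(m.1 - p k).toNat, by omega⟩ ⟨(m.2 - q l).toNat, by omega⟩
  simp only [Int.toNat_of_nonneg (sub_nonneg.2 hk), Int.toNat_of_nonneg (sub_nonneg.2 hl),
    add_sub_cancel] at h1 h2
  exact h1.trans h2.symm

namespace MetallicMean

variable {n : ℕ}

/-- The self-similarity of the metallic mean Wang shift. -/
noncomputable def selfSimilarity (n : ℕ) (hn : 1 ≤ n) : Substitution (Omega n) (Omega n) where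
  rule := rule n hn
  toFun x := ⟨(exists_configImage hn x.2).choose, (exists_configImage hn x.2).choose_spec.1⟩
  isConfigImage x := (exists_configImage hn x.2).choose_spec.2

theorem shift_mem {x : Config (tiles n)} (hx : x ∈ Omega n) (k : ℤ × ℤ) :
    shift k x ∈ Omega n := fun i j => by
  have := hx (i + k.1) (j + k.2)
  simpa [shift, Prod.add_def, add_right_comm] using this

theorem isOntoUpToShift (hn : 1 ≤ n) : (selfSimilarity n hn).IsOntoUpToShift := by
  ext y
  constructor
  · intro hy
    obtain ⟨p, q, F, E, hFE, hp, hq, hH, hV⟩ :=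
      (tightGrid_of_mem hy).exists_blocks (by exact_mod_cast hn)
    let x : Config (tiles n) := fun m =>
      ⟨⟨F (m.1 + 1) m.2, E m.1 (m.2 + 1), F m.1 m.2, E m.1 m.2⟩, (mem_tiles_iff _).2 (hFE _ _)⟩
    have hx : x ∈ Omega n := fun i j => ⟨rfl, rfl⟩
    have hp1 : ∀ k, p k < p (k + 1) := fun k => by
      rw [hp k 0]; have := (width_pos hn (x (k, 0))).1; simp only [x] at this; omega
    have hq1 : ∀ k, q k < q (k + 1) := fun k => by
      rw [hq 0 k]; have := (width_pos hn (x (0, k))).2; simp only [x] at this; omega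
    have hz : IsConfigImage (rule n hn) x (shift (p 0, q 0) y) := by
      refine ⟨fun k => p k - p 0, fun k => q k - q 0, sub_self _, sub_self _, fun k l => ?_,
        fun k l => ?_, fun m => ?_, fun m => ?_, fun k l a b => Subtype.ext ?_⟩
      · beta_reduce; rw [rule_width, hp k l]; ring
      · beta_reduce; rw [rule_height, hq k l]; ring
      · obtain ⟨k, hk, hk'⟩ := exists_le_lt_add_one hp1 (m + p 0)
        exact ⟨k, by beta_reduce; omega, by beta_reduce; omega⟩
      · obtain ⟨k, hk, hk'⟩ := exists_le_lt_add_one hq1 (m + q 0)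
        exact ⟨k, by beta_reduce; omega, by beta_reduce; omega⟩
      · have ha := a.isLt; have hb := b.isLt
        rw [← Int.ofNat_lt, rule_width] at ha
        rw [← Int.ofNat_lt, rule_height] at hb
        simp only [x] at ha hb
        have e1 : p k - p 0 + (a : ℕ) + p 0 = p k + (a : ℕ) := by ring
        have e2 : q l - q 0 + (b : ℕ) + q 0 = q l + (b : ℕ) := by ring
        simp only [shift, Prod.mk_add_mk, e1, e2, rule, blockTile, x]
        have h1 := hH k l a b (by omega) (by omega) (by omega) (by omega)
        have h2 := hH k l a (b + 1) (by omega) (by omega) (by omega) (by omega)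
        have h3 := hV k l a b (by omega) (by omega) (by omega) (by omega)
        have h4 := hV k l (a + 1) b (by omega) (by omega) (by omega) (by omega)
        have h5 := hy (p k + (a : ℕ)) (q l + (b : ℕ))
        rw [← h1, ← h2, ← h3, ← h4, ← add_assoc, ← add_assoc, ← h5.1, ← h5.2]
    -- The image of `x` puts the corner of block `(0, 0)` at the origin, whereas in `y` it lies at
    -- `(p 0, q 0)`.
    refine ⟨(-p 0, -q 0), _, ⟨⟨x, hx⟩, rfl⟩, ?_⟩
    rw [((selfSimilarity n hn).isConfigImage ⟨x, hx⟩).unique hz]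
    funext m
    have : m + (-p 0, -q 0) + (p 0, q 0) = m := Prod.ext (by simp) (by simp)
    simp only [shift, this]
  · rintro ⟨k, z, ⟨x, rfl⟩, rfl⟩
    exact shift_mem ((selfSimilarity n hn).toFun x).2 k

theorem edge_fst_eq_zero (n : ℤ) (e f : Label) (a b : ℤ) : (edge n e f a b).1 = 0 ↔ a = 0 := by
  unfold edge; split_ifs with h <;> simp [h]

theorem isRecognizable (hn : 1 ≤ n) : (selfSimilarity n hn).IsRecognizable := by
  -- Block positions are taken relative to `y`. Their ranges are then the stripes of `y`,
  -- independent of the representation, and centeredness fixes the index 0, so the positions and `k`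
  -- are determined.
  have key : ∀ y k x, (selfSimilarity n hn).IsCenteredRep y k x → ∃ p q : ℤ → ℤ,
      p 0 = -k.1 ∧ q 0 = -k.2 ∧ (StrictMono p ∧ p 0 ≤ 0 ∧ 0 < p 1) ∧
      (StrictMono q ∧ q 0 ≤ 0 ∧ 0 < q 1) ∧
      (∀ k l, p (k + 1) = p k + width n (x.1 (k, l)).1.bottom) ∧
      (∀ k l, q (l + 1) = q l + width n (x.1 (k, l)).1.left) ∧
      Set.range p = {i | (y (i, 0)).1.bottom.1 = 0} ∧ Set.range q = {j | (y (0, j)).1.left.1 = 0} ∧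
      ∀ k l a b, 0 ≤ a → a < width n (x.1 (k, l)).1.bottom → 0 ≤ b →
        b < width n (x.1 (k, l)).1.left →
        (y (p k + a, q l + b)).1 = blockTile n (x.1 (k, l)).1 a b := by
    rintro y k x ⟨rfl, ⟨hk1, hk1'⟩, hk2, hk2'⟩
    obtain ⟨p, q, p0, q0, hp, hq, hpc, hqc, hz⟩ := (selfSimilarity n hn).isConfigImage x
    have hp' : ∀ k l, p (k + 1) = p k + width n (x.1 (k, l)).1.bottom := fun k l => by
      rw [hp k l]; exact congrArg _ (rule_width hn _)
    have hq' : ∀ k l, q (l + 1) = q l + width n (x.1 (k, l)).1.left := fun k l => by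
      rw [hq k l]; exact congrArg _ (rule_height hn _)
    have hp1 : ∀ k, p k < p (k + 1) := fun k => by
      rw [hp' k 0]; have := (width_pos hn (x.1 (k, 0))).1; omega
    have hq1 : ∀ k, q k < q (k + 1) := fun k => by
      rw [hq' 0 k]; have := (width_pos hn (x.1 (0, k))).2; omega
    set z := ((selfSimilarity n hn).toFun x).1
    have hzb : ∀ k l a b, 0 ≤ a → a < width n (x.1 (k, l)).1.bottom → 0 ≤ b →
        b < width n (x.1 (k, l)).1.left →
        (z (p k + a, q l + b)).1 = blockTile n (x.1 (k, l)).1 a b := by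
      intro k l a b ha ha' hb hb'
      rw [← rule_width hn] at ha'
      rw [← rule_height hn] at hb'
      have := hz k l ⟨a.toNat, by change _ < (rule n hn _).width; omega⟩
        ⟨b.toNat, by change _ < (rule n hn _).height; omega⟩
      simp only [Int.toNat_of_nonneg ha, Int.toNat_of_nonneg hb] at this
      rw [this]
      change blockTile n _ (a.toNat : ℤ) (b.toNat : ℤ) = _
      rw [Int.toNat_of_nonneg ha, Int.toNat_of_nonneg hb]
    have hstripe : ∀ i j, ((z (i, j)).1.bottom.1 = 0 ↔ i ∈ Set.range p) ∧
        ((z (i, j)).1.left.1 = 0 ↔ j ∈ Set.range q) := by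
      intro i j
      obtain ⟨k, hk, hk'⟩ := hpc i
      obtain ⟨l, hl, hl'⟩ := hqc j
      have h1 := hzb k l (i - p k) (j - q l) (by omega) (by rw [hp' k l] at hk'; omega) (by omega)
        (by rw [hq' k l] at hl'; omega)
      rw [add_sub_cancel, add_sub_cancel] at h1
      rw [h1]
      simp only [blockTile, edge_fst_eq_zero]
      constructor
      · constructor
        · exact fun h => ⟨k, by omega⟩
        · rintro ⟨k', rfl⟩
          rw [eq_of_le_lt_add_one hp1 hk hk' le_rfl (hp1 k'), sub_self]
      · constructor
        · exact fun h => ⟨l, by omega⟩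
        · rintro ⟨l', rfl⟩
          rw [eq_of_le_lt_add_one hq1 hl hl' le_rfl (hq1 l'), sub_self]
    have hw0 := rule_width hn (x.1 (0, 0))
    have hh0 := rule_height hn (x.1 (0, 0))
    have hp01 := hp' 0 0
    have hq01 := hq' 0 0
    rw [zero_add] at hp01 hq01
    refine ⟨fun κ => p κ - k.1, fun κ => q κ - k.2, by simp [p0], by simp [q0],
      ⟨fun a b hab => by have := strictMono_of_lt_add_one hp1 hab; simpa using this,
        by simp [p0, hk1], ?_⟩,
      ⟨fun a b hab => by have := strictMono_of_lt_add_one hq1 hab; simpa using this,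
        by simp [q0, hk2], ?_⟩, fun κ l => by simp only [hp' κ l]; ring,
      fun κ l => by simp only [hq' κ l]; ring, ?_, ?_, fun κ l a b ha ha' hb hb' => ?_⟩
    · have : (k.1 : ℤ) < (rule n hn (x.1 (0, 0))).width := hk1'
      simp only; omega
    · have : (k.2 : ℤ) < (rule n hn (x.1 (0, 0))).height := hk2'
      simp only; omega
    · ext i
      have : ∀ i, (i, 0) + k = (i + k.1, 0 + k.2) := fun i => rfl
      simp only [shift, this, Set.mem_range, Set.mem_ofPred_eq, (hstripe _ _).1]
      exact exists_congr fun κ => by omega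
    · ext j
      have : ∀ j, (0, j) + k = (0 + k.1, j + k.2) := fun j => rfl
      simp only [shift, this, Set.mem_range, Set.mem_ofPred_eq, (hstripe _ _).2]
      exact exists_congr fun κ => by omega
    · rw [← hzb κ l a b ha ha' hb hb']
      have : ((p κ - k.1 + a, q l - k.2 + b) + k : ℤ × ℤ) = (p κ + a, q l + b) :=
        Prod.ext (by simp; ring) (by simp; ring)
      simp only [shift, this]
  intro y k k' x x' h h'
  obtain ⟨p, q, p0, q0, ⟨hp1, hp2, hp3⟩, ⟨hq1, hq2, hq3⟩, hp4, hq4, hpr, hqr, hy⟩ := key y k x h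
  obtain ⟨p', q', p0', q0', ⟨hp1', hp2', hp3'⟩, ⟨hq1', hq2', hq3'⟩, hp4', hq4', hpr', hqr', hy'⟩ :=
    key y k' x' h'
  obtain rfl : p = p' := enumeration_unique hp1 hp1' (hpr.trans hpr'.symm) hp2 hp3 hp2' hp3'
  obtain rfl : q = q' := enumeration_unique hq1 hq1' (hqr.trans hqr'.symm) hq2 hq3 hq2' hq3'
  refine ⟨Prod.ext (by omega) (by omega), ?_⟩
  have hn' : (1 : ℤ) ≤ n := by exact_mod_cast hn
  have hwb : ∀ k l, width n (x.1 (k, l)).1.bottom = width n (x'.1 (k, l)).1.bottom := fun k l => by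
    have := hp4 k l; have := hp4' k l; omega
  have hwl : ∀ k l, width n (x.1 (k, l)).1.left = width n (x'.1 (k, l)).1.left := fun k l => by
    have := hq4 k l; have := hq4' k l; omega
  have hlab : ∀ t : tiles n, IsLabel n t.1.left ∧ IsLabel n t.1.bottom := fun t =>
    ((tight_of_mem t).loose.isLabel hn').2.2
  have hb : ∀ k l, (x.1 (k, l)).1.bottom = (x'.1 (k, l)).1.bottom := fun k l =>
    label_eq_of_edge hn' (hlab _).2 (hlab _).2 (hwb k l) fun a ha ha' => by
      have h1 := hy k l a 0 ha ha' le_rfl (width_pos hn _).2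
      have h2 := hy' k l a 0 ha (by rwa [← hwb]) le_rfl (width_pos hn _).2
      exact congrArg WangTile.bottom (h1.symm.trans h2)
  have hl : ∀ k l, (x.1 (k, l)).1.left = (x'.1 (k, l)).1.left := fun k l =>
    label_eq_of_edge hn' (hlab _).1 (hlab _).1 (hwl k l) fun b hb hb' => by
      have h1 := hy k l 0 b le_rfl (width_pos hn _).1 hb hb'
      have h2 := hy' k l 0 b le_rfl (width_pos hn _).1 hb (by rwa [← hwl])
      exact congrArg WangTile.left (h1.symm.trans h2)
  refine Subtype.ext (funext fun m => Subtype.ext ?_)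
  have e1 := x.2 m.1 m.2
  have e2 := x'.2 m.1 m.2
  have e3 : ∀ t t' : WangTile Label, t.right = t'.right → t.top = t'.top → t.left = t'.left →
      t.bottom = t'.bottom → t = t' := by
    rintro ⟨⟩ ⟨⟩ rfl rfl rfl rfl; rfl
  -- Right and top labels are left and bottom labels of the neighbors.
  exact e3 _ _ (by rw [e1.1, e2.1, hl]) (by rw [e1.2, e2.2, hb]) (hl _ _) (hb _ _)

/-! ### The number of tiles -/

/-- A parametrization of the tiles. -/
def tileOfCode (n : ℤ) :
    (ℤ × ℤ) ⊕ (ℤ ⊕ ℤ ⊕ ℤ) ⊕ (ℤ ⊕ ℤ ⊕ ℤ) ⊕ (ℤ × ℤ × ℤ × ℤ) → WangTile Label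
  | .inl (i, j) => ⟨(1, 1, i + 1), (1, 1, j + 1), (1, 1, i), (1, 1, j)⟩
  | .inr (.inl (.inl i)) => ⟨(0, 0, i + 1), (1, 1, 1), (0, 0, i), (1, 1, n)⟩
  | .inr (.inl (.inr (.inl i))) => ⟨(0, 1, i + 1), (1, 1, 1), (0, 0, i), (1, 1, n + 1)⟩
  | .inr (.inl (.inr (.inr i))) => ⟨(0, 1, i + 1), (1, 1, 2), (0, 1, i), (1, 1, n + 1)⟩
  | .inr (.inr (.inl (.inl i))) => ⟨(1, 1, 1), (0, 0, i + 1), (1, 1, n), (0, 0, i)⟩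
  | .inr (.inr (.inl (.inr (.inl i)))) => ⟨(1, 1, 1), (0, 1, i + 1), (1, 1, n + 1), (0, 0, i)⟩
  | .inr (.inr (.inl (.inr (.inr i)))) => ⟨(1, 1, 2), (0, 1, i + 1), (1, 1, n + 1), (0, 1, i)⟩
  | .inr (.inr (.inr (k, l, r, s))) => ⟨(0, k, l), (0, r, s), (0, s, r + n), (0, l, k + n)⟩

theorem tileOfCode_injective (n : ℤ) : Function.Injective (tileOfCode n) := by
  rintro (⟨i, j⟩ | (i | i | i) | (i | i | i) | ⟨k, l, r, s⟩)
    (⟨i', j'⟩ | (i' | i' | i') | (i' | i' | i') | ⟨k', l', r', s'⟩) h <;>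
  simp only [tileOfCode, WangTile.mk.injEq, Prod.mk.injEq] at h <;>
  first
  | (exfalso; omega)
  | (simp only [Sum.inl.injEq, Sum.inr.injEq, Prod.mk.injEq]; omega)

/-- The codes of the seven junctions. -/
def junctionCodes : Finset (ℤ × ℤ × ℤ × ℤ) :=
  {(0, 0, 0, 0), (0, 0, 0, 1), (0, 1, 0, 0), (0, 1, 0, 1), (0, 1, 1, 1), (1, 1, 0, 1), (1, 1, 1, 1)}

/-- The codes of the tiles. -/
noncomputable def tileCodes (n : ℕ) : Finset ((ℤ × ℤ) ⊕ (ℤ ⊕ ℤ ⊕ ℤ) ⊕ (ℤ ⊕ ℤ ⊕ ℤ) ⊕ (ℤ × ℤ × ℤ × ℤ)) :=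
  let stripes := (Finset.Ico (0 : ℤ) n).disjSum
    ((Finset.Icc (0 : ℤ) n).disjSum (Finset.Icc (1 : ℤ) n))
  (Finset.Icc (1 : ℤ) n ×ˢ Finset.Icc (1 : ℤ) n).disjSum
    (stripes.disjSum (stripes.disjSum junctionCodes))

theorem tiles_eq_image (n : ℕ) : tiles n = tileOfCode n '' tileCodes n := by
  ext ⟨⟨a1, a2, a3⟩, ⟨b1, b2, b3⟩, ⟨c1, c2, c3⟩, ⟨d1, d2, d3⟩⟩
  rw [mem_tiles_iff]
  simp only [Tight, IsWhite, IsStripe, IsJunction]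
  constructor
  · rintro (h | h | h | h)
    · refine ⟨.inl (c3, d3), ?_, ?_⟩
      · simp [tileCodes]; omega
      · simp only [tileOfCode, WangTile.mk.injEq, Prod.mk.injEq, and_true]; omega
    · by_cases hr : a2 = 0
      · refine ⟨.inr (.inl (.inl c3)), ?_, ?_⟩
        · simp [tileCodes]; omega
        · simp only [tileOfCode, WangTile.mk.injEq, Prod.mk.injEq, and_true]; omega
      · by_cases hl : c2 = 0
        · refine ⟨.inr (.inl (.inr (.inl c3))), ?_, ?_⟩
          · simp [tileCodes]; omega
          · simp only [tileOfCode, WangTile.mk.injEq, Prod.mk.injEq, and_true]; omega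
        · refine ⟨.inr (.inl (.inr (.inr c3))), ?_, ?_⟩
          · simp [tileCodes]; omega
          · simp only [tileOfCode, WangTile.mk.injEq, Prod.mk.injEq, and_true]; omega
    · by_cases hr : b2 = 0
      · refine ⟨.inr (.inr (.inl (.inl d3))), ?_, ?_⟩
        · simp [tileCodes]; omega
        · simp only [tileOfCode, WangTile.mk.injEq, Prod.mk.injEq, and_true]; omega
      · by_cases hl : d2 = 0
        · refine ⟨.inr (.inr (.inl (.inr (.inl d3)))), ?_, ?_⟩
          · simp [tileCodes]; omega
          · simp only [tileOfCode, WangTile.mk.injEq, Prod.mk.injEq, and_true]; omega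
        · refine ⟨.inr (.inr (.inl (.inr (.inr d3)))), ?_, ?_⟩
          · simp [tileCodes]; omega
          · simp only [tileOfCode, WangTile.mk.injEq, Prod.mk.injEq, and_true]; omega
    · refine ⟨.inr (.inr (.inr (a2, a3, b2, b3))), ?_, ?_⟩
      · simp [tileCodes, junctionCodes]; omega
      · simp only [tileOfCode, WangTile.mk.injEq, Prod.mk.injEq, and_true]; omega
  · rintro ⟨c, hc, h⟩
    rcases c with ⟨i, j⟩ | (i | i | i) | (i | i | i) | ⟨k, l, r, s⟩ <;>
    simp only [tileOfCode, WangTile.mk.injEq, Prod.mk.injEq] at h <;>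
    simp [tileCodes, junctionCodes] at hc
    · refine .inl ?_; omega
    iterate 3 refine .inr (.inl ?_); omega
    iterate 3 refine .inr (.inr (.inl ?_)); omega
    refine .inr (.inr (.inr ?_)); omega

theorem ncard_tiles (n : ℕ) : (tiles n).ncard = (n + 3) ^ 2 := by
  have hj : junctionCodes.card = 7 := by decide
  rw [tiles_eq_image, Set.ncard_image_of_injective _ (tileOfCode_injective n),
    Set.ncard_coe_finset]
  simp [tileCodes, Finset.card_disjSum, Finset.card_product, hj]
  ring

theorem finite_tiles (n : ℕ) : Finite (tiles n) :=
  Set.finite_of_ncard_ne_zero (by rw [ncard_tiles]; positivity)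

theorem nonempty_tiles (n : ℕ) : Nonempty (tiles n) :=
  (Set.nonempty_of_ncard_ne_zero (by rw [ncard_tiles]; positivity)).to_subtype

/-! ### The subshift -/

theorem isSubshift_Omega (n : ℕ) : IsSubshift (Omega n) := by
  constructor
  · let _ : TopologicalSpace (tiles n) := ⊥
    have : DiscreteTopology (tiles n) := ⟨rfl⟩
    have key : ∀ (a b : ℤ × ℤ) (S : Set (tiles n × tiles n)),
        IsClosed {x : Config (tiles n) | (x a, x b) ∈ S} := fun a b S =>
      (isClosed_discrete S).preimage (f := fun x : Config (tiles n) => (x a, x b))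
        ((continuous_apply a).prodMk (continuous_apply b))
    have : Omega n = ⋂ i : ℤ, ⋂ j : ℤ,
        ({x | (x (i, j), x (i + 1, j)) ∈ {t : tiles n × tiles n | t.1.1.right = t.2.1.left}} ∩
        {x | (x (i, j), x (i, j + 1)) ∈ {t : tiles n × tiles n | t.1.1.top = t.2.1.bottom}}) := by
      ext x
      simp only [Omega, wangShift, Set.mem_ofPred_eq, Set.mem_iInter, Set.mem_inter_iff]
    rw [this]
    exact isClosed_iInter fun i => isClosed_iInter fun j => (key _ _ _).inter (key _ _ _)
  · ext y
    constructor
    · rintro ⟨k, x, hx, rfl⟩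
      exact shift_mem hx k
    · exact fun hy => ⟨0, y, hy, by funext m; simp [shift]⟩

/-! ### Iterates of the substitution -/

/-- The lower left `w × h` corner of the first quadrant of a configuration. -/
def toWord {A : Type*} (x : Config A) (w h : ℕ) : Word A := ⟨w, h, fun i j => x ((i : ℕ), (j : ℕ))⟩

/-- The word `toWord x w h` is a valid patch. -/
def ValidOn (x : Config (tiles n)) (w h : ℤ) : Prop :=
  ∀ i j : ℤ, 0 ≤ i → i < w → 0 ≤ j → j < h →
    (i + 1 < w → (x (i, j)).1.right = (x (i + 1, j)).1.left) ∧
    (j + 1 < h → (x (i, j)).1.top = (x (i, j + 1)).1.bottom)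

theorem ValidOn.width_bottom {x : Config (tiles n)} {w h : ℤ} (hx : ValidOn x w h) {k l : ℤ}
    (hk : 0 ≤ k) (hk' : k < w) (hl : 0 ≤ l) (hl' : l < h) :
    width n (x (k, l)).1.bottom = width n (x (k, 0)).1.bottom := by
  induction l, hl using Int.leInduction with
  | base => rfl
  | succ l hl ih =>
    rw [← (hx k l hk hk' hl (by omega)).2 hl', width_top, ih (by omega)]

theorem ValidOn.width_left {x : Config (tiles n)} {w h : ℤ} (hx : ValidOn x w h) {k l : ℤ}
    (hk : 0 ≤ k) (hk' : k < w) (hl : 0 ≤ l) (hl' : l < h) :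
    width n (x (k, l)).1.left = width n (x (0, l)).1.left := by
  induction k, hk using Int.leInduction with
  | base => rfl
  | succ k hk ih =>
    rw [← (hx k l hk (by omega) hl hl').1 hk', width_right, ih (by omega)]

/-- Even if all other columns have width 1, the excess of column 0 makes the image wider. -/
theorem partialSums_growth {p : ℤ → ℤ} (hp : ∀ k, p k < p (k + 1)) {w : ℤ}
    (hw : 0 < w) : w + (p 1 - 1) ≤ p w := by
  have hmono : Monotone fun k => p k - k :=
    monotone_int_of_le_succ fun k => by have := hp k; omega
  have := hmono (show (1 : ℤ) ≤ w by omega)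
  simp only at this; omega

/-- The image of a valid patch is a valid patch. -/
theorem ValidOn.exists_image (hn : 1 ≤ n) {x : Config (tiles n)} {w h : ℕ} (hx : ValidOn x w h)
    (hw : 0 < w) (hh : 0 < h) :
    ∃ (y : Config (tiles n)) (w' h' : ℕ), ValidOn y w' h' ∧
      IsWordImage (rule n hn) (toWord x w h) (toWord y w' h') ∧ w ≤ w' ∧ h ≤ h' ∧
      (y (0, 0)).1.bottom.1 = 0 ∧ (y (0, 0)).1.left.1 = 0 ∧
      ((x (0, 0)).1.bottom.1 = 0 → w < w') ∧ ((x (0, 0)).1.left.1 = 0 → h < h') := by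
  obtain ⟨p, p0, hp⟩ := exists_partialSums fun k => width n (x (k, 0)).1.bottom
  obtain ⟨q, q0, hq⟩ := exists_partialSums fun l => width n (x (0, l)).1.left
  have hp1 : ∀ k, p k < p (k + 1) := fun k => by rw [hp]; have := (width_pos hn (x (k, 0))).1; omega
  have hq1 : ∀ k, q k < q (k + 1) := fun k => by rw [hq]; have := (width_pos hn (x (0, k))).2; omega
  have hp2 : ∀ k ∈ Set.Ico (0 : ℤ) w, ∀ l ∈ Set.Ico (0 : ℤ) h,
      p (k + 1) = p k + width n (x (k, l)).1.bottom := fun k hk l hl => by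
    rw [hp, hx.width_bottom hk.1 hk.2 hl.1 hl.2]
  have hq2 : ∀ k ∈ Set.Ico (0 : ℤ) w, ∀ l ∈ Set.Ico (0 : ℤ) h,
      q (l + 1) = q l + width n (x (k, l)).1.left := fun k hk l hl => by
    rw [hq, hx.width_left hk.1 hk.2 hl.1 hl.2]
  obtain ⟨y, hy, hy'⟩ := exists_concat hn x hp1 hq1 hp2 hq2
    (fun k hk l hl hk1 => (hx k l hk.1 hk.2 hl.1 hl.2).1 hk1.2)
    (fun k hk l hl hl1 => (hx k l hk.1 hk.2 hl.1 hl.2).2 hl1.2)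
  have hpm := strictMono_of_lt_add_one hp1
  have hqm := strictMono_of_lt_add_one hq1
  have gp := partialSums_growth hp1 (w := w) (by omega)
  have gq := partialSums_growth hq1 (w := h) (by omega)
  have hp01 := hp 0
  have hq01 := hq 0
  rw [zero_add, p0, zero_add] at hp01
  rw [zero_add, q0, zero_add] at hq01
  have w0 := width_pos hn (x (0, 0))
  have hpnn : ∀ k : ℕ, 0 ≤ p k := fun k => p0 ▸ hpm.monotone (by omega)
  have hqnn : ∀ k : ℕ, 0 ≤ q k := fun k => q0 ▸ hqm.monotone (by omega)
  have y00 := hy 0 ⟨le_rfl, by omega⟩ 0 ⟨le_rfl, by omega⟩ 0 0 le_rfl w0.1 le_rfl w0.2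
  rw [p0, q0, add_zero] at y00
  refine ⟨y, (p w).toNat, (q h).toNat, ?_, ?_, by omega, by omega, ?_, ?_, ?_, ?_⟩
  · intro i j hi hi' hj hj'
    rw [Int.toNat_of_nonneg (hpnn w)] at hi' ⊢
    rw [Int.toNat_of_nonneg (hqnn h)] at hj' ⊢
    obtain ⟨k, hk, hk'⟩ := exists_le_lt_add_one hp1 i
    obtain ⟨l, hl, hl'⟩ := exists_le_lt_add_one hq1 j
    have k1 : -1 < k := by
      have : (0 : ℤ) < k + 1 := hpm.lt_iff_lt.1 (by omega)
      omega
    have k2 : k < w := hpm.lt_iff_lt.1 (by omega)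
    have l1 : -1 < l := by
      have : (0 : ℤ) < l + 1 := hqm.lt_iff_lt.1 (by omega)
      omega
    have l2 : l < h := hqm.lt_iff_lt.1 (by omega)
    have := hy' k ⟨by omega, k2⟩ l ⟨by omega, l2⟩ i j hk hk' hl hl'
    refine ⟨fun h1 => this.1 ?_, fun h1 => this.2 ?_⟩
    · by_cases hkw : k + 1 = w
      · left; rwa [hkw]
      · exact .inr ⟨by omega, by omega⟩
    · by_cases hlh : l + 1 = h
      · left; rwa [hlh]
      · exact .inr ⟨by omega, by omega⟩
  · refine ⟨fun k => (p k).toNat, fun l => (q l).toNat, by simp [p0], by simp [q0], rfl, rfl,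
      fun i j => ?_, fun i j => ?_, fun i j => ?_⟩
    all_goals
      have hi := i.isLt
      have hj := j.isLt
      simp only [toWord] at hi hj
      have e1 := hp2 i ⟨by omega, by omega⟩ j ⟨by omega, by omega⟩
      have e2 := hq2 i ⟨by omega, by omega⟩ j ⟨by omega, by omega⟩
      have e3 := rule_width hn (x ((i : ℕ), (j : ℕ)))
      have e4 := rule_height hn (x ((i : ℕ), (j : ℕ)))
      have e5 := hpnn i
      have e6 := hqnn j
    · simp only [toWord]; push_cast; omega
    · simp only [toWord]; push_cast; omega
    · have m1 : p ((i : ℕ) + 1) ≤ p w := hpm.monotone (by omega)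
      have m2 : q ((j : ℕ) + 1) ≤ q h := hqm.monotone (by omega)
      refine ⟨by simp only [toWord]; omega, by simp only [toWord]; omega, fun a b => Subtype.ext ?_⟩
      have ha := a.isLt
      have hb := b.isLt
      simp only [toWord] at ha hb
      have := hy i ⟨by omega, by omega⟩ j ⟨by omega, by omega⟩ a b (by omega) (by omega) (by omega)
        (by omega)
      simp only [toWord]
      push_cast
      rw [Int.toNat_of_nonneg e5, Int.toNat_of_nonneg e6, this]
      rfl
  · rw [y00]; simp only [blockTile, edge_fst_eq_zero]
  · rw [y00]; simp only [blockTile, edge_fst_eq_zero]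
  · intro h0; simp only [width, h0] at hp01; omega
  · intro h0; simp only [width, h0] at hq01; omega

/-- For `n = 1` a white tile does not grow, so the induction also carries the junction in the lower
left corner, present from the first iterate on; it adds at least one column and one row each time.
-/
theorem exists_iterate (hn : 1 ≤ n) (t : tiles n) (m : ℕ) :
    ∃ (x : Config (tiles n)) (w h : ℕ), ValidOn x w h ∧ 0 < w ∧ 0 < h ∧ m ≤ w ∧ m ≤ h ∧
      IsIterate (rule n hn) m (Word.letter t) (toWord x w h) ∧
      (m = 0 ∨ (x (0, 0)).1.bottom.1 = 0 ∧ (x (0, 0)).1.left.1 = 0) := by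
  induction m with
  | zero =>
    refine ⟨fun _ => t, 1, 1, fun i j _ _ _ _ => ⟨fun _ => ?_, fun _ => ?_⟩, one_pos, one_pos,
      zero_le_one, zero_le_one, rfl, .inl rfl⟩ <;> omega
  | succ m ih =>
    obtain ⟨x, w, h, hx, hw, hh, hmw, hmh, hit, hst⟩ := ih
    obtain ⟨y, w', h', hy, him, hww, hhh, hb, hl, hw', hh'⟩ := hx.exists_image hn hw hh
    refine ⟨y, w', h', hy, by omega, by omega, ?_, ?_, ⟨_, hit, him⟩, .inr ⟨hb, hl⟩⟩
    · rcases hst with h0 | ⟨h0, -⟩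
      · omega
      · have := hw' h0; omega
    · rcases hst with h0 | ⟨-, h0⟩
      · omega
      · have := hh' h0; omega

theorem isExpansive_rule (hn : 1 ≤ n) : IsExpansive (rule n hn) := fun t K => by
  obtain ⟨x, w, h, -, -, -, hw, hh, hit, -⟩ := exists_iterate hn t (K + 1)
  exact ⟨K + 1, _, hit, lt_min hw hh⟩

/-- Compactness: patches of size at least `2 * N`, shifted by `(N, N)`, have an ultrafilter limit
because the alphabet is finite. Each adjacency involves only three cells, which lie inside the patch
for large `N`. -/
theorem nonempty_Omega (hn : 1 ≤ n) : (Omega n).Nonempty := by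
  obtain ⟨t⟩ := nonempty_tiles n
  have := finite_tiles n
  choose x w h hx _ _ hw hh _ _ using fun N : ℕ => exists_iterate hn t (2 * N)
  let z : ℕ → Config (tiles n) := fun N => shift ((N : ℤ), (N : ℤ)) (x N)
  have hlim : ∀ m, ∃ s, ∀ᶠ N in Filter.hyperfilter ℕ, z N m = s := fun m => by
    obtain ⟨s, hs⟩ := ((Filter.hyperfilter ℕ).map fun N => z N m).eq_pure_of_finite
    refine ⟨s, ?_⟩
    have h1 : {s} ∈ (Filter.hyperfilter ℕ).map fun N => z N m := by
      rw [hs]; exact Ultrafilter.mem_pure.2 rfl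
    exact Ultrafilter.mem_map.1 h1
  choose y hy using hlim
  refine ⟨y, fun i j => ?_⟩
  have hlarge : ∀ᶠ N in Filter.hyperfilter ℕ, i.natAbs + j.natAbs + 2 ≤ N :=
    Nat.hyperfilter_le_atTop (Filter.eventually_ge_atTop _)
  obtain ⟨N, h0, h1, h2, h3⟩ := (hlarge.and ((hy (i, j)).and
    ((hy (i + 1, j)).and (hy (i, j + 1))))).exists
  rw [← h1, ← h2, ← h3]
  have hwN := hw N
  have hhN := hh N
  have hv := hx N (i + N) (j + N) (by omega) (by omega) (by omega) (by omega)
  simp only [z, shift, Prod.mk_add_mk, add_right_comm _ (1 : ℤ)]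
  exact ⟨hv.1 (by omega), hv.2 (by omega)⟩

end MetallicMean

theorem theoremA (n : ℕ) (hn : 1 ≤ n) :
    (MetallicMean.tiles n).ncard = (n + 3) ^ 2 ∧
    (MetallicMean.Omega n).Nonempty ∧
    IsSelfSimilar (MetallicMean.Omega n) ∧
    ∃ ω : Substitution (MetallicMean.Omega n) (MetallicMean.Omega n),
      IsExpansive ω.rule ∧ ω.IsRecognizable ∧ ω.IsOntoUpToShift :=
  ⟨MetallicMean.ncard_tiles n, MetallicMean.nonempty_Omega hn,
    ⟨MetallicMean.isSubshift_Omega n, MetallicMean.selfSimilarity n hn,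
      MetallicMean.isExpansive_rule hn, MetallicMean.isOntoUpToShift hn⟩,
    MetallicMean.selfSimilarity n hn, MetallicMean.isExpansive_rule hn,
    MetallicMean.isRecognizable hn, MetallicMean.isOntoUpToShift hn⟩
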